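/- Let $n\ge 3$, $\gamma\in(0,2)$, $\beta=\frac{2}{2-\gamma}$, $\alpha=\gamma\beta=\frac{2\gamma}{2-\gamma}$, let $\Omega\subset\mathbb R^n$ be a domain (open, connected), and let $u:\Omega\to[0,\infty)$ be a continuous function in $H^1_{loc}(\Omega)$ that is a stable critical point of the Alt–Phillips functional $$E_\gamma^{AP}[u]=\int_\Omega\big(|\nabla u|^2+u^\gamma\chi_{\{u>0\}}\big)\,dx$$ with respect to domain variations, that is, for every $\Phi\in C_c^\infty(\Omega;\mathbb R^n)$ the first variation vanishes, $$\int_\Omega(|\nabla u|^2+u^\gamma\chi_{\{u>0\}})\operatorname{div}\Phi\,dx-2\int_\Omega\nabla u\cdot D\Phi\nabla u\,dx=0,$$ and the second variation is nonnegative, $$\int_\Omega(|\nabla u|^2+u^\gamma\chi_{\{u>0\}})\frac{(\operatorname{div}\Phi)^2-\operatorname{Tr}(D\Phi)^2}{2}\,dx+\int_\Omega|D\Phi^{\top}\nabla u|^2\,dx+\int_\Omega\big(2\nabla u\cdot (D\Phi)^2\nabla u-2(\nabla u\cdot D\Phi\nabla u)\operatorname{div}\Phi\big)\,dx\ge0 .$$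 (These are the coefficients of $\varepsilon$ and $\varepsilon^2$ in the expansion of the energy of $u\circ(\mathrm{id}+\varepsilon\Phi)^{-1}$.) Assume that $u$ is axially symmetric: for some unit vector $e$, $u(x)$ depends only on $\tau:=|x-(x\cdot e)e|$ and on $x\cdot e$ (after a rotation, $e=e_n$, $x=(x',x_n)$ and $\tau=|x'|$). Let $w_\tau:=\nabla w\cdot\frac{x-(x\cdot e)e}{\tau}$ denote the derivative in the direction of increasing $\tau$ (defined for $\tau>0$). Put $v:=\beta u^{1/\beta}$. Assume that $0\in\partial\{u>0\}\cap\Omega$, that $\partial\{u>0\}\cap\Omega$ is a $C^\infty$ hypersurface away from $0$, and that $v$ is $C^\infty$ up to the free boundary away from $0$, that is, $v\in C^\infty\big((\overline{\{v>0\}}\cap\Omega)\setminus\{0\}\big)$: near each point of this set, $v|_{\{v>0\}}$ is the restriction of a $C^\infty$ function. Then for every $\eta\in C^1_c(\Omega)$ $$(n-2)\int_{\{u>0\}\cap\Omega}\frac{u_\tau^2}{\tau^2}\,\eta^2\,dx\le\int_{\{u>0\}\cap\Omega}u_\tau^2\,|\nabla\eta|^2\,dx$$ and, equivalently, $$(n-2)\int_{\{v>0\}\cap\Omega}v^\alpha\frac{v_\tau^2}{\tau^2}\,\eta^2\,dx\le\int_{\{v>0\}\cap\Omega}v^\alpha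 v_\tau^2\,|\nabla\eta|^2\,dx,$$ all four integrals being finite. -/

import Mathlib

open MeasureTheory Set
open scoped ContDiff RealInnerProductSpace

noncomputable section

namespace AltPhillips

variable {n : ℕ}

/-- Test functions: `C^k` maps on the whole space whose support is a compact subset of `Ω`. -/
def IsTest {F : Type*} [NormedAddCommGroup F] [NormedSpace ℝ F] (k : WithTop ℕ∞)
    (Ω : Set (EuclideanSpace ℝ (Fin n))) (φ : EuclideanSpace ℝ (Fin n) → F) : Prop :=
  ContDiff ℝ k φ ∧ HasCompactSupport φ ∧ tsupport φ ⊆ Ω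

/-- `u` belongs to `H¹_loc(Ω)` and `g` is its weak gradient in `Ω`. -/
structure IsH1LocWithGradient (Ω : Set (EuclideanSpace ℝ (Fin n)))
    (u : EuclideanSpace ℝ (Fin n) → ℝ)
    (g : EuclideanSpace ℝ (Fin n) → EuclideanSpace ℝ (Fin n)) : Prop where
  memLp_fun : ∀ K : Set (EuclideanSpace ℝ (Fin n)), IsCompact K → K ⊆ Ω →
    MemLp u 2 (volume.restrict K)
  memLp_grad : ∀ K : Set (EuclideanSpace ℝ (Fin n)), IsCompact K → K ⊆ Ω →
    MemLp g 2 (volume.restrict K)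
  integral_by_parts : ∀ φ : EuclideanSpace ℝ (Fin n) → ℝ, IsTest ∞ Ω φ →
    ∀ w : EuclideanSpace ℝ (Fin n),
      ∫ x in Ω, u x * fderiv ℝ φ x w = - ∫ x in Ω, ⟪g x, w⟫ * φ x

/-- The divergence of a vector field: the trace of its differential. -/
def divergence (Φ : EuclideanSpace ℝ (Fin n) → EuclideanSpace ℝ (Fin n))
    (x : EuclideanSpace ℝ (Fin n)) : ℝ :=
  LinearMap.trace ℝ (EuclideanSpace ℝ (Fin n))
    (fderiv ℝ Φ x : EuclideanSpace ℝ (Fin n) →ₗ[ℝ] EuclideanSpace ℝ (Fin n))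

/-- The trace of the square `(DΦ)²` of the differential of a vector field. -/
def traceSq (Φ : EuclideanSpace ℝ (Fin n) → EuclideanSpace ℝ (Fin n))
    (x : EuclideanSpace ℝ (Fin n)) : ℝ :=
  LinearMap.trace ℝ (EuclideanSpace ℝ (Fin n))
    ((fderiv ℝ Φ x).comp (fderiv ℝ Φ x) :
      EuclideanSpace ℝ (Fin n) →ₗ[ℝ] EuclideanSpace ℝ (Fin n))

/-- The Alt-Phillips energy density `|∇u|² + u^γ χ_{u>0}`, with `g` in the role of `∇u`. -/
def energyDensity (γ : ℝ) (u : EuclideanSpace ℝ (Fin n) → ℝ)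
    (g : EuclideanSpace ℝ (Fin n) → EuclideanSpace ℝ (Fin n))
    (x : EuclideanSpace ℝ (Fin n)) : ℝ :=
  ‖g x‖ ^ 2 + {y | 0 < u y}.indicator (fun y => u y ^ γ) x

/-- The coefficient of `ε` in the expansion of the Alt-Phillips energy of
`u ∘ (id + ε Φ)⁻¹` in powers of `ε`. -/
def firstVariation (γ : ℝ) (Ω : Set (EuclideanSpace ℝ (Fin n)))
    (u : EuclideanSpace ℝ (Fin n) → ℝ)
    (g Φ : EuclideanSpace ℝ (Fin n) → EuclideanSpace ℝ (Fin n)) : ℝ :=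
  (∫ x in Ω, energyDensity γ u g x * divergence Φ x)
    - 2 * ∫ x in Ω, ⟪g x, fderiv ℝ Φ x (g x)⟫

/-- The coefficient of `ε²` in the expansion of the Alt-Phillips energy of
`u ∘ (id + ε Φ)⁻¹` in powers of `ε`. -/
def secondVariation (γ : ℝ) (Ω : Set (EuclideanSpace ℝ (Fin n)))
    (u : EuclideanSpace ℝ (Fin n) → ℝ)
    (g Φ : EuclideanSpace ℝ (Fin n) → EuclideanSpace ℝ (Fin n)) : ℝ :=
  (∫ x in Ω, energyDensity γ u g x * ((divergence Φ x ^ 2 - traceSq Φ x) / 2))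
    + (∫ x in Ω, ‖ContinuousLinearMap.adjoint (fderiv ℝ Φ x) (g x)‖ ^ 2)
    + ∫ x in Ω, (2 * ⟪g x, fderiv ℝ Φ x (fderiv ℝ Φ x (g x))⟫
        - 2 * ⟪g x, fderiv ℝ Φ x (g x)⟫ * divergence Φ x)

/-- `u` is a stable critical point of the Alt-Phillips functional in `Ω`: it is in `H¹_loc(Ω)`, its
first variation with respect to compactly supported smooth domain deformations vanishes, and its
second variation is nonnegative. -/
def IsStableCriticalPoint (γ : ℝ) (Ω : Set (EuclideanSpace ℝ (Fin n)))
    (u : EuclideanSpace ℝ (Fin n) → ℝ) : Prop :=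
  ∃ g : EuclideanSpace ℝ (Fin n) → EuclideanSpace ℝ (Fin n),
    IsH1LocWithGradient Ω u g ∧
    ∀ Φ : EuclideanSpace ℝ (Fin n) → EuclideanSpace ℝ (Fin n), IsTest ∞ Ω Φ →
      firstVariation γ Ω u g Φ = 0 ∧ 0 ≤ secondVariation γ Ω u g Φ

/-- The positivity set `{u > 0} ∩ Ω`. -/
def positivitySet (Ω : Set (EuclideanSpace ℝ (Fin n))) (u : EuclideanSpace ℝ (Fin n) → ℝ) :
    Set (EuclideanSpace ℝ (Fin n)) :=
  {x | x ∈ Ω ∧ 0 < u x}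

/-- The free boundary `∂{u > 0} ∩ Ω`. -/
def freeBoundary (Ω : Set (EuclideanSpace ℝ (Fin n))) (u : EuclideanSpace ℝ (Fin n) → ℝ) :
    Set (EuclideanSpace ℝ (Fin n)) :=
  frontier (positivitySet Ω u) ∩ Ω

/-- `S` is a `C^∞` embedded hypersurface near its point `p`: it is locally the zero set of a smooth
function with nonvanishing differential. -/
def IsSmoothHypersurfaceAt (S : Set (EuclideanSpace ℝ (Fin n)))
    (p : EuclideanSpace ℝ (Fin n)) : Prop :=
  ∃ (U : Set (EuclideanSpace ℝ (Fin n))) (ψ : EuclideanSpace ℝ (Fin n) → ℝ),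
    IsOpen U ∧ p ∈ U ∧ ContDiffOn ℝ ∞ ψ U ∧ fderiv ℝ ψ p ≠ 0 ∧ S ∩ U = {x | x ∈ U ∧ ψ x = 0}

/-- The function `v`, restricted to `P`, is `C^∞` up to the point `p` of the closure of `P`: near
`p` it is the restriction to `P` of a smooth function. -/
def IsSmoothUpToAt (P : Set (EuclideanSpace ℝ (Fin n))) (v : EuclideanSpace ℝ (Fin n) → ℝ)
    (p : EuclideanSpace ℝ (Fin n)) : Prop :=
  ∃ (U : Set (EuclideanSpace ℝ (Fin n))) (w : EuclideanSpace ℝ (Fin n) → ℝ),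
    IsOpen U ∧ p ∈ U ∧ ContDiffOn ℝ ∞ w U ∧ EqOn v w (U ∩ P)

/-- The component of `x` orthogonal to the axis spanned by the unit vector `e`. -/
def transversal (e x : EuclideanSpace ℝ (Fin n)) : EuclideanSpace ℝ (Fin n) :=
  x - ⟪e, x⟫ • e

/-- The distance `τ` of `x` to the axis spanned by the unit vector `e`. -/
def axisDist (e x : EuclideanSpace ℝ (Fin n)) : ℝ := ‖transversal e x‖

/-- In `Ω`, the function `u` depends only on the distance to the axis spanned by the unit vector `e`
and on the coordinate along it. -/
def IsAxiallySymmetric (e : EuclideanSpace ℝ (Fin n)) (Ω : Set (EuclideanSpace ℝ (Fin n)))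
    (u : EuclideanSpace ℝ (Fin n) → ℝ) : Prop :=
  ∃ f : ℝ → ℝ → ℝ, ∀ x ∈ Ω, u x = f (axisDist e x) ⟪e, x⟫

/-- The derivative `u_τ` of `u` in the direction pointing away from the axis. -/
def derivTau (e : EuclideanSpace ℝ (Fin n)) (u : EuclideanSpace ℝ (Fin n) → ℝ)
    (x : EuclideanSpace ℝ (Fin n)) : ℝ :=
  fderiv ℝ u x ((axisDist e x)⁻¹ • transversal e x)

/-- The exponent `β = 2 / (2 - γ)`. -/
def betaExp (γ : ℝ) : ℝ := 2 / (2 - γ)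

/-- The exponent `α = 2γ / (2 - γ)`. -/
def alphaExp (γ : ℝ) : ℝ := 2 * γ / (2 - γ)

/-- The function `v = β u^{1/β}`. -/
def modified (γ : ℝ) (u : EuclideanSpace ℝ (Fin n) → ℝ) (x : EuclideanSpace ℝ (Fin n)) : ℝ :=
  betaExp γ * u x ^ (1 / betaExp γ)

end AltPhillips

end

/-!
The inequality follows from inner variations alone: the first and second variations are tested with
smooth fields proportional to the transversal component `p = x - ⟪e, x⟫ e` of the position.

For a smooth test function `ζ`, consider `Φ = ζ p` and `Ψ = ζ² p`. Then
`((div Φ)² - Tr (DΦ)²) / 2 = (n - 2) / 2 · div Ψ` pointwise, so the vanishing of the first variation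
along `Ψ` eliminates the energy density from the second variation along `Φ`. Axial symmetry makes
`∇u` a combination of `e` and `p`, and what is left is (`variation_integrand_identity`,
`integral_radialForm_nonneg`)
`0 ≤ ∫_{u > 0} u_τ² (τ² |∇ζ|² + 2 ζ (p · ∇ζ) - (n - 3) ζ²)`.
For `ζ = η / τ` the bracket is `|∇η|² - (n - 2) η² / τ²`, which is the claim.

This choice is singular on the axis, and `u_τ²` is only known to be locally integrable near the
origin. Therefore `1 / τ` is replaced by `(τ² + ε²)^{-1/2}`. With `r = τ² / (τ² + ε²)` the form
becomes a sum of `r |∇η|²`, of a mixed term with the factor `1 - r`, and of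
`- η² (n - 2 - (1 - r)²) / (τ² + ε²)`. The gap `1 - (1 - r)² ≥ r` suffices to absorb the mixed term
by Young's inequality even if `n = 3` (`radialForm_mul_regInv_le`), with an arbitrarily small loss
`θ`. Fatou's lemma and dominated convergence then give the inequality as `ε → 0` and `θ → 0`
(`hardy_of_integral_radialForm_nonneg`).

The free boundary enters only through the fact that the weak gradient of `u` is the classical one on
`{u > 0}` and vanishes almost everywhere on `{u = 0}` (`IsH1LocWithGradient.ae_eq_gradient`,
`IsH1LocWithGradient.ae_eq_zero`). The version for `v` is the version for `u` multiplied by `β^α`,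
since `v^α v_τ² = β^α u_τ²` (`modified_rpow_mul_derivTau_sq`).
-/

noncomputable section

namespace AltPhillips

variable {n : ℕ}

open Filter Topology

/-! ### Deformation fields along the transversal component of the position -/

/-- The orthogonal projection `x ↦ x - ⟪e, x⟫ e` along the axis, as a continuous linear map. -/
def transversalCLM (e : EuclideanSpace ℝ (Fin n)) :
    EuclideanSpace ℝ (Fin n) →L[ℝ] EuclideanSpace ℝ (Fin n) :=
  ContinuousLinearMap.id ℝ _ - (innerSL ℝ e).smulRight e

@[simp]
lemma transversalCLM_apply (e x : EuclideanSpace ℝ (Fin n)) :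
    transversalCLM e x = transversal e x := by
  simp [transversalCLM, transversal]

lemma inner_transversal_self_left {e : EuclideanSpace ℝ (Fin n)} (he : ‖e‖ = 1)
    (x : EuclideanSpace ℝ (Fin n)) : ⟪e, transversal e x⟫ = 0 := by
  simp [transversal, inner_sub_right, inner_smul_right, he]

lemma transversal_of_inner_eq_zero {e p : EuclideanSpace ℝ (Fin n)} (h : ⟪e, p⟫ = 0) :
    transversal e p = p := by
  simp [transversal, h]

lemma transversal_self {e : EuclideanSpace ℝ (Fin n)} (he : ‖e‖ = 1) : transversal e e = 0 := by
  simp [transversal, he]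

/-- The differential of the field `ζ p`, `p` the transversal component of the position, at a point
where `ζ` has the value `z` and the gradient `q`. -/
def radialDifferential (e p q : EuclideanSpace ℝ (Fin n)) (z : ℝ) :
    EuclideanSpace ℝ (Fin n) →L[ℝ] EuclideanSpace ℝ (Fin n) :=
  (innerSL ℝ q).smulRight p + z • transversalCLM e

lemma radialDifferential_apply (e p q w : EuclideanSpace ℝ (Fin n)) (z : ℝ) :
    radialDifferential e p q z w = ⟪q, w⟫ • p + z • transversal e w := by
  simp [radialDifferential]

lemma trace_transversalCLM {e : EuclideanSpace ℝ (Fin n)} (he : ‖e‖ = 1) :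
    LinearMap.trace ℝ _ (transversalCLM e : EuclideanSpace ℝ (Fin n) →ₗ[ℝ] _) = n - 1 := by
  have h : (transversalCLM e : EuclideanSpace ℝ (Fin n) →ₗ[ℝ] EuclideanSpace ℝ (Fin n)) =
      LinearMap.id - ((innerSL ℝ e : EuclideanSpace ℝ (Fin n) →ₗ[ℝ] ℝ).smulRight e) := by
    ext x; simp [transversalCLM]
  rw [h, map_sub, LinearMap.trace_id, LinearMap.trace_smulRight]
  simp [he]

lemma trace_smulRight_inner (p q : EuclideanSpace ℝ (Fin n)) :
    LinearMap.trace ℝ _ (((innerSL ℝ q).smulRight p : EuclideanSpace ℝ (Fin n) →L[ℝ] _) :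
      EuclideanSpace ℝ (Fin n) →ₗ[ℝ] EuclideanSpace ℝ (Fin n)) = ⟪q, p⟫ := by
  have h : (((innerSL ℝ q).smulRight p : EuclideanSpace ℝ (Fin n) →L[ℝ] _) :
      EuclideanSpace ℝ (Fin n) →ₗ[ℝ] EuclideanSpace ℝ (Fin n)) =
      (innerSL ℝ q : EuclideanSpace ℝ (Fin n) →ₗ[ℝ] ℝ).smulRight p := by
    ext x; simp
  rw [h, LinearMap.trace_smulRight]
  simp

lemma trace_radialDifferential {e : EuclideanSpace ℝ (Fin n)} (he : ‖e‖ = 1)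
    (p q : EuclideanSpace ℝ (Fin n)) (z : ℝ) :
    LinearMap.trace ℝ _ (radialDifferential e p q z : EuclideanSpace ℝ (Fin n) →ₗ[ℝ] _) =
      ⟪q, p⟫ + z * (n - 1) := by
  rw [radialDifferential, ContinuousLinearMap.toLinearMap_add, ContinuousLinearMap.toLinearMap_smul,
    map_add, map_smul, trace_transversalCLM he, trace_smulRight_inner]
  simp

lemma inner_transversal_left (e x y : EuclideanSpace ℝ (Fin n)) :
    ⟪transversal e x, y⟫ = ⟪x, transversal e y⟫ := by
  simp only [transversal, inner_sub_left, inner_sub_right, inner_smul_left, inner_smul_right,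
    RCLike.conj_to_real]
  rw [real_inner_comm e x]; ring

lemma trace_radialDifferential_comp_self {e : EuclideanSpace ℝ (Fin n)} (he : ‖e‖ = 1)
    {p : EuclideanSpace ℝ (Fin n)} (hp : ⟪e, p⟫ = 0) (q : EuclideanSpace ℝ (Fin n)) (z : ℝ) :
    LinearMap.trace ℝ _ ((radialDifferential e p q z).comp (radialDifferential e p q z) :
        EuclideanSpace ℝ (Fin n) →ₗ[ℝ] EuclideanSpace ℝ (Fin n)) =
      ⟪q, p⟫ ^ 2 + 2 * z * ⟪q, p⟫ + z ^ 2 * (n - 1) := by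
  have h : (radialDifferential e p q z).comp (radialDifferential e p q z) =
      (⟪q, p⟫ + z) • (innerSL ℝ q).smulRight p
        + (z • (innerSL ℝ (transversal e q)).smulRight p + z ^ 2 • transversalCLM e) := by
    ext1 w
    have h2 : transversal e (transversal e w) = transversal e w :=
      transversal_of_inner_eq_zero (inner_transversal_self_left he w)
    have h3 (a b : ℝ) : transversal e (a • p + b • transversal e w)
        = a • p + b • transversal e w := by
      rw [← transversalCLM_apply, map_add, map_smul, map_smul]
      simp [transversal_of_inner_eq_zero hp, h2]
    simp only [ContinuousLinearMap.comp_apply, radialDifferential_apply, h3,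
      _root_.add_apply, _root_.smul_apply,
      ContinuousLinearMap.smulRight_apply, innerSL_apply_apply, transversalCLM_apply,
      inner_transversal_left, inner_add_right, inner_smul_right]
    module
  rw [h]
  simp only [ContinuousLinearMap.toLinearMap_add, ContinuousLinearMap.toLinearMap_smul, map_add,
    map_smul,
    trace_transversalCLM he, trace_smulRight_inner, inner_transversal_left,
    transversal_of_inner_eq_zero hp, smul_eq_mul]
  ring

/-- The pointwise identity behind the stability inequality, at a point where `∇u = a e + b p`. On
the left, the terms of the second variation along `ζ p` that do not contain the energy density, plus
`(n - 2)` times the corresponding term of the first variation along `ζ² p`. On the right `b² |p|²`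
stands for `u_τ²`. -/
lemma variation_integrand_identity {e : EuclideanSpace ℝ (Fin n)} (he : ‖e‖ = 1)
    {p : EuclideanSpace ℝ (Fin n)} (hp : ⟪e, p⟫ = 0) (q : EuclideanSpace ℝ (Fin n)) (z a b : ℝ)
    (g : EuclideanSpace ℝ (Fin n)) (hg : g = a • e + b • p) :
    ‖ContinuousLinearMap.adjoint (radialDifferential e p q z) g‖ ^ 2
      + (2 * ⟪g, radialDifferential e p q z (radialDifferential e p q z g)⟫
          - 2 * ⟪g, radialDifferential e p q z g⟫ * (⟪q, p⟫ + z * (n - 1)))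
      + (n - 2) * ⟪g, radialDifferential e p ((2 * z) • q) (z ^ 2) g⟫
      = b ^ 2 * ‖p‖ ^ 2 * (‖p‖ ^ 2 * ‖q‖ ^ 2 + 2 * z * ⟪q, p⟫ - (n - 3) * z ^ 2) := by
  have hTg : transversal e g = b • p := by
    rw [← transversalCLM_apply, hg, map_add, map_smul, map_smul]
    simp [transversal_of_inner_eq_zero hp, transversal_self he]
  have hgp : ⟪g, p⟫ = b * ‖p‖ ^ 2 := by
    rw [hg, inner_add_left, inner_smul_left, inner_smul_left, hp, real_inner_self_eq_norm_sq]
    simp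
  have hA : ContinuousLinearMap.adjoint (radialDifferential e p q z) g
      = (b * ‖p‖ ^ 2) • q + (z * b) • p := by
    refine ext_inner_right ℝ fun w => ?_
    rw [ContinuousLinearMap.adjoint_inner_left, radialDifferential_apply, inner_add_right,
      inner_smul_right, inner_smul_right, ← inner_transversal_left, hTg, inner_add_left,
      inner_smul_left, inner_smul_left, inner_smul_left, hgp]
    simp only [RCLike.conj_to_real]
    ring
  have hTA : transversal e (⟪q, g⟫ • p + z • b • p) = ⟪q, g⟫ • p + z • b • p := by
    rw [← transversalCLM_apply, map_add, map_smul, map_smul, map_smul, transversalCLM_apply,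
      transversal_of_inner_eq_zero hp]
  have hn : ‖(b * ‖p‖ ^ 2) • q + (z * b) • p‖ ^ 2
      = (b * ‖p‖ ^ 2) ^ 2 * ‖q‖ ^ 2 + 2 * (b * ‖p‖ ^ 2) * (z * b) * ⟪q, p⟫
        + (z * b) ^ 2 * ‖p‖ ^ 2 := by
    rw [← real_inner_self_eq_norm_sq, inner_add_left, inner_add_right, inner_add_right]
    simp only [inner_smul_left, inner_smul_right, RCLike.conj_to_real, real_inner_self_eq_norm_sq,
      real_inner_comm q p]
    ring
  rw [hA, hn]
  simp only [radialDifferential_apply, hTg, hTA, inner_add_right, inner_smul_right, inner_smul_left,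
    hgp, RCLike.conj_to_real]
  ring

lemma contDiff_transversal {k : WithTop ℕ∞} (e : EuclideanSpace ℝ (Fin n)) :
    ContDiff ℝ k (transversal e) := by
  have : transversal e = transversalCLM e := by ext1 x; simp
  rw [this]; exact (transversalCLM e).contDiff

lemma hasFDerivAt_transversal (e x : EuclideanSpace ℝ (Fin n)) :
    HasFDerivAt (transversal e) (transversalCLM e) x := by
  have : transversal e = transversalCLM e := by ext1 x; simp
  rw [this]; exact (transversalCLM e).hasFDerivAt

lemma inner_gradient_eq_fderiv (f : EuclideanSpace ℝ (Fin n) → ℝ)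
    (x w : EuclideanSpace ℝ (Fin n)) : ⟪gradient f x, w⟫ = fderiv ℝ f x w := by
  simp [gradient]

lemma norm_gradient (f : EuclideanSpace ℝ (Fin n) → ℝ) (x : EuclideanSpace ℝ (Fin n)) :
    ‖gradient f x‖ = ‖fderiv ℝ f x‖ := by
  simp [gradient]

/-- The differential of the deformation field `ζ p`. -/
lemma fderiv_smul_transversal (e : EuclideanSpace ℝ (Fin n)) {ζ : EuclideanSpace ℝ (Fin n) → ℝ}
    {x : EuclideanSpace ℝ (Fin n)} (hζ : DifferentiableAt ℝ ζ x) :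
    fderiv ℝ (fun y => ζ y • transversal e y) x =
      radialDifferential e (transversal e x) (gradient ζ x) (ζ x) := by
  have hT := hasFDerivAt_transversal e x
  have h := (hζ.hasFDerivAt.smul hT).fderiv
  rw [show (fun y => ζ y • transversal e y) = ζ • transversal e from rfl, h]
  ext1 w
  simp [radialDifferential_apply, add_comm]

lemma gradient_sq {ζ : EuclideanSpace ℝ (Fin n) → ℝ}
    {x : EuclideanSpace ℝ (Fin n)} (hζ : DifferentiableAt ℝ ζ x) :
    gradient (fun y => ζ y ^ 2) x = (2 * ζ x) • gradient ζ x := by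
  refine ext_inner_right ℝ fun w => ?_
  rw [inner_smul_left, inner_gradient_eq_fderiv, inner_gradient_eq_fderiv, fderiv_fun_pow 2 hζ]
  simp

/-! ### The weak gradient of a function that is smooth where it is positive -/

lemma positivitySet_subset (Ω : Set (EuclideanSpace ℝ (Fin n)))
    (u : EuclideanSpace ℝ (Fin n) → ℝ) : positivitySet Ω u ⊆ Ω := fun _ hx => hx.1

lemma isOpen_positivitySet {Ω : Set (EuclideanSpace ℝ (Fin n))} (hΩ : IsOpen Ω)
    {u : EuclideanSpace ℝ (Fin n) → ℝ} (hu : ContinuousOn u Ω) : IsOpen (positivitySet Ω u) :=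
  hu.isOpen_inter_preimage hΩ isOpen_Ioi

/-- Smoothness of `v = β u^{1/β}` at a point of positivity passes to `u = (v / β)^β`. -/
lemma contDiffAt_of_isSmoothUpToAt {γ : ℝ} (hγ : γ < 2) {Ω : Set (EuclideanSpace ℝ (Fin n))}
    (hΩ : IsOpen Ω) {u : EuclideanSpace ℝ (Fin n) → ℝ} (hu : ContinuousOn u Ω)
    {x : EuclideanSpace ℝ (Fin n)} (hx : x ∈ positivitySet Ω u)
    (h : IsSmoothUpToAt (positivitySet Ω u) (modified γ u) x) : ContDiffAt ℝ 1 u x := by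
  have hβ : 0 < betaExp γ := by unfold betaExp; apply div_pos <;> linarith
  obtain ⟨U, w, hU, hxU, hw, heq⟩ := h
  have hPo := isOpen_positivitySet hΩ hu
  have hinv : ∀ y ∈ U ∩ positivitySet Ω u, u y = (w y / betaExp γ) ^ betaExp γ := by
    intro y hy
    rw [← heq hy, modified, mul_div_cancel_left₀ _ hβ.ne', ← Real.rpow_mul hy.2.2.le,
      one_div_mul_cancel hβ.ne', Real.rpow_one]
  have hpos : 0 < w x := by
    rw [← heq ⟨hxU, hx⟩, modified]; exact mul_pos hβ (Real.rpow_pos_of_pos hx.2 _)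
  have hwx : ContDiffAt ℝ 1 w x :=
    (hw.contDiffAt (hU.mem_nhds hxU)).of_le (by exact_mod_cast le_top)
  refine ((hwx.div_const (betaExp γ)).rpow_const_of_ne (p := betaExp γ)
    (div_pos hpos hβ).ne').congr_of_eventuallyEq ?_
  filter_upwards [(hU.inter hPo).mem_nhds ⟨hxU, hx⟩] with y hy using hinv y hy

lemma integrable_mul_of_integrableOn_tsupport {F φ : EuclideanSpace ℝ (Fin n) → ℝ}
    (hφ : Continuous φ) (hc : HasCompactSupport φ) (hF : IntegrableOn F (tsupport φ)) :
    Integrable (fun x => F x * φ x) :=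
  (hF.mul_continuousOn hφ.continuousOn hc).integrable_of_forall_notMem_eq_zero
    fun x hx => by simp [image_eq_zero_of_notMem_tsupport hx]

lemma IsH1LocWithGradient.integrableOn {Ω : Set (EuclideanSpace ℝ (Fin n))}
    {u : EuclideanSpace ℝ (Fin n) → ℝ} {g : EuclideanSpace ℝ (Fin n) → EuclideanSpace ℝ (Fin n)}
    (h : IsH1LocWithGradient Ω u g) {K : Set (EuclideanSpace ℝ (Fin n))} (hK : IsCompact K)
    (hKΩ : K ⊆ Ω) : IntegrableOn g K := by
  have : IsFiniteMeasure (volume.restrict K) := ⟨by simpa using hK.measure_lt_top⟩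
  exact (h.memLp_grad K hK hKΩ).integrable one_le_two

lemma continuousOn_gradient {P : Set (EuclideanSpace ℝ (Fin n))} (hP : IsOpen P)
    {u : EuclideanSpace ℝ (Fin n) → ℝ} (hu : ∀ x ∈ P, ContDiffAt ℝ 1 u x) :
    ContinuousOn (gradient u) P := by
  have h : ContDiffOn ℝ 1 u P := fun x hx => (hu x hx).contDiffWithinAt
  exact (InnerProductSpace.toDual ℝ _).symm.continuous.comp_continuousOn
    (h.continuousOn_fderiv_of_isOpen hP le_rfl)

lemma setIntegral_eq_integral_of_tsupport {Ω : Set (EuclideanSpace ℝ (Fin n))}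
    {φ F : EuclideanSpace ℝ (Fin n) → ℝ} (hφ : tsupport φ ⊆ Ω)
    (hF : ∀ x ∉ tsupport φ, F x = 0) : ∫ x in Ω, F x = ∫ x, F x :=
  setIntegral_eq_integral_of_forall_compl_eq_zero fun x hx => hF x fun h => hx (hφ h)

lemma fderiv_apply_eq_zero_of_notMem_tsupport {φ : EuclideanSpace ℝ (Fin n) → ℝ}
    {x : EuclideanSpace ℝ (Fin n)} (hx : x ∉ tsupport φ) : fderiv ℝ φ x = 0 :=
  image_eq_zero_of_notMem_tsupport fun h => hx (tsupport_fderiv_subset ℝ h)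

/-- A locally integrable field whose components are orthogonal to all test functions vanishes. -/
lemma ae_eq_zero_of_forall_integral_inner_mul {U : Set (EuclideanSpace ℝ (Fin n))} (hU : IsOpen U)
    {f : EuclideanSpace ℝ (Fin n) → EuclideanSpace ℝ (Fin n)} (hf : LocallyIntegrableOn f U)
    (h : ∀ φ : EuclideanSpace ℝ (Fin n) → ℝ, IsTest ∞ U φ → ∀ w, ∫ x, ⟪f x, w⟫ * φ x = 0) :
    ∀ᵐ x, x ∈ U → f x = 0 := by
  refine hU.ae_eq_zero_of_integral_contDiff_smul_eq_zero hf fun φ h1 h2 h3 => ?_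
  have hint : Integrable (fun x => φ x • f x) := by
    have : IntegrableOn f (tsupport φ) := hf.integrableOn_compact_subset h3 h2
    refine (this.continuousOn_smul h1.continuous.continuousOn h2
      ).integrable_of_forall_notMem_eq_zero fun x hx => ?_
    simp [image_eq_zero_of_notMem_tsupport hx]
  refine ext_inner_right ℝ fun w => ?_
  rw [inner_zero_left, real_inner_comm, ← integral_inner hint w, ← h φ ⟨h1, h2, h3⟩ w]
  congr 1; ext x
  rw [inner_smul_right, real_inner_comm, mul_comm]

/-- Where `u` is `C¹` its weak gradient is its gradient. -/
lemma IsH1LocWithGradient.ae_eq_gradient {Ω P : Set (EuclideanSpace ℝ (Fin n))} (hP : IsOpen P)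
    (hPΩ : P ⊆ Ω) {u : EuclideanSpace ℝ (Fin n) → ℝ}
    {g : EuclideanSpace ℝ (Fin n) → EuclideanSpace ℝ (Fin n)}
    (h : IsH1LocWithGradient Ω u g) (hu : ∀ x ∈ P, ContDiffAt ℝ 1 u x) :
    ∀ᵐ x, x ∈ P → g x = gradient u x := by
  have hgr := continuousOn_gradient hP hu
  have hg : LocallyIntegrableOn g P :=
    (locallyIntegrableOn_iff hP.isLocallyClosed).2
      fun K hK hKc => h.integrableOn hKc (hK.trans hPΩ)
  have hgr' : LocallyIntegrableOn (gradient u) P :=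
    hgr.locallyIntegrableOn hP.measurableSet
  have key := ae_eq_zero_of_forall_integral_inner_mul hP (hg.sub hgr') fun φ hφ w => ?_
  · filter_upwards [key] with x hx hxP
    simpa [sub_eq_zero] using hx hxP
  · obtain ⟨h1, h2, h3⟩ := hφ
    have hK : IntegrableOn (fun x => ⟪g x, w⟫) (tsupport φ) :=
      Integrable.inner_const (hg.integrableOn_compact_subset h3 h2) w
    have hK' : IntegrableOn (fun x => fderiv ℝ u x w) (tsupport φ) := by
      simp_rw [← inner_gradient_eq_fderiv]
      exact Integrable.inner_const (hgr'.integrableOn_compact_subset h3 h2) w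
    have i1 := integrable_mul_of_integrableOn_tsupport h1.continuous h2 hK
    have i2 := integrable_mul_of_integrableOn_tsupport h1.continuous h2 hK'
    have hucont : ContinuousOn u (tsupport φ) :=
      fun x hx => (hu x (h3 hx)).continuousAt.continuousWithinAt
    have i3 : Integrable (fun x => u x * φ x) :=
      integrable_mul_of_integrableOn_tsupport h1.continuous h2 (hucont.integrableOn_compact h2)
    have hdφ : Continuous (fun x => fderiv ℝ φ x w) :=
      (h1.continuous_fderiv (by simp)).clm_apply continuous_const
    have i4 : Integrable (fun x => u x * fderiv ℝ φ x w) := by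
      refine ((hucont.mul hdφ.continuousOn).integrableOn_compact
        h2).integrable_of_forall_notMem_eq_zero fun x hx => ?_
      simp [fderiv_apply_eq_zero_of_notMem_tsupport hx]
    have e1 := h.integral_by_parts φ ⟨h1, h2, h3.trans hPΩ⟩ w
    rw [setIntegral_eq_integral_of_tsupport (h3.trans hPΩ) fun x hx => by
        simp [fderiv_apply_eq_zero_of_notMem_tsupport hx],
      setIntegral_eq_integral_of_tsupport (h3.trans hPΩ) fun x hx => by
        simp [image_eq_zero_of_notMem_tsupport hx]] at e1
    have e2 := integral_mul_fderiv_eq_neg_fderiv_mul_of_integrable i2 i4 i3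
      (fun x hx => (hu x (h3 hx)).differentiableAt (by simp))
      (fun x _ => h1.contDiffAt.differentiableAt (by simp))
    have e3 : ∫ x, ⟪(g - gradient u) x, w⟫ * φ x
        = (∫ x, ⟪g x, w⟫ * φ x) - ∫ x, fderiv ℝ u x w * φ x := by
      rw [← integral_sub i1 i2]
      congr 1; ext x
      rw [Pi.sub_apply, inner_sub_left, inner_gradient_eq_fderiv, sub_mul]
    rw [e3]; linarith

/-- A `C¹` truncation of the identity on `[0, ∞)`: it vanishes up to `δ`, is nondecreasing and
`1`-Lipschitz, and tends to the identity as `δ → 0`. -/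
def truncation (δ t : ℝ) : ℝ := √(max (t - δ) 0 ^ 2 + δ ^ 2) - δ

/-- The derivative of `truncation δ`. -/
def truncationDeriv (δ t : ℝ) : ℝ := max (t - δ) 0 / √(max (t - δ) 0 ^ 2 + δ ^ 2)

lemma hasDerivAt_max_zero_sq (s : ℝ) :
    HasDerivAt (fun s : ℝ => max s 0 ^ 2) (2 * max s 0) s := by
  rcases lt_trichotomy s 0 with h | h | h
  · rw [max_eq_right h.le, mul_zero]
    refine (hasDerivAt_const s (0 : ℝ)).congr_of_eventuallyEq ?_
    filter_upwards [gt_mem_nhds h] with t ht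
    simp [max_eq_right ht.le]
  · subst h
    rw [hasDerivAt_iff_isLittleO]
    have : (fun s : ℝ => max s 0 ^ 2) =O[𝓝 0] fun s : ℝ => s ^ 2 := by
      refine Asymptotics.IsBigO.of_bound 1 (Eventually.of_forall fun s => ?_)
      rw [norm_pow, norm_pow, one_mul]
      refine pow_le_pow_left₀ (norm_nonneg _) ?_ 2
      rw [Real.norm_eq_abs, Real.norm_eq_abs, abs_of_nonneg (le_max_right _ _)]
      exact max_le (le_abs_self s) (abs_nonneg s)
    simpa using this.trans_isLittleO (Asymptotics.isLittleO_pow_id one_lt_two)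
  · rw [max_eq_left h.le]
    have := hasDerivAt_pow 2 s
    simp only [Nat.cast_ofNat, Nat.add_one_sub_one, pow_one] at this
    refine this.congr_of_eventuallyEq ?_
    filter_upwards [lt_mem_nhds h] with t ht
    simp [max_eq_left ht.le]

lemma hasDerivAt_truncation {δ : ℝ} (hδ : 0 < δ) (t : ℝ) :
    HasDerivAt (truncation δ) (truncationDeriv δ t) t := by
  have h1 : HasDerivAt (fun t : ℝ => max (t - δ) 0 ^ 2) (2 * max (t - δ) 0) t :=
    (hasDerivAt_max_zero_sq (t - δ)).comp_sub_const t δ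
  have h2 := ((h1.add_const (δ ^ 2)).sqrt (by positivity)).sub_const δ
  refine h2.congr_deriv ?_
  unfold truncationDeriv
  rw [mul_div_mul_left _ _ two_ne_zero]

lemma truncation_of_le {δ t : ℝ} (hδ : 0 < δ) (ht : t ≤ δ) : truncation δ t = 0 := by
  simp [truncation, max_eq_right (sub_nonpos.2 ht), Real.sqrt_sq hδ.le]

lemma truncationDeriv_of_le {δ t : ℝ} (ht : t ≤ δ) : truncationDeriv δ t = 0 := by
  simp [truncationDeriv, max_eq_right (sub_nonpos.2 ht)]

lemma abs_truncationDeriv_le_one (δ t : ℝ) : |truncationDeriv δ t| ≤ 1 := by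
  unfold truncationDeriv
  have h : max (t - δ) 0 ≤ √(max (t - δ) 0 ^ 2 + δ ^ 2) :=
    Real.le_sqrt_of_sq_le (by nlinarith [sq_nonneg δ])
  rw [abs_of_nonneg (div_nonneg (le_max_right _ _) (Real.sqrt_nonneg _))]
  exact div_le_one_of_le₀ h (Real.sqrt_nonneg _)

lemma abs_truncation_le {δ t : ℝ} (hδ : 0 < δ) (ht : 0 ≤ t) : |truncation δ t| ≤ t := by
  unfold truncation
  have h0 : δ ≤ √(max (t - δ) 0 ^ 2 + δ ^ 2) :=
    Real.le_sqrt_of_sq_le (by nlinarith [sq_nonneg (max (t - δ) 0)])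
  have h1 : √(max (t - δ) 0 ^ 2 + δ ^ 2) ≤ max (t - δ) 0 + δ :=
    Real.sqrt_le_iff.2 ⟨by positivity, by nlinarith [le_max_right (t - δ) 0]⟩
  have h2 : max (t - δ) 0 ≤ t := max_le (by linarith) ht
  rw [abs_of_nonneg (by linarith)]; linarith

lemma continuous_truncation_left (t : ℝ) : Continuous fun δ => truncation δ t := by
  unfold truncation; fun_prop

lemma truncation_zero {t : ℝ} (ht : 0 ≤ t) : truncation 0 t = t := by
  simp [truncation, max_eq_left ht, Real.sqrt_sq ht]

lemma tendsto_truncationDeriv {t : ℝ} (ht : 0 < t) :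
    Tendsto (fun δ => truncationDeriv δ t) (𝓝 0) (𝓝 1) := by
  have h : ContinuousAt (fun δ => truncationDeriv δ t) 0 := by
    unfold truncationDeriv
    refine ContinuousAt.div (by fun_prop) (by fun_prop) ?_
    simp [max_eq_left ht.le, Real.sqrt_sq ht.le, ht.ne']
  have h0 : truncationDeriv 0 t = 1 := by
    simp [truncationDeriv, max_eq_left ht.le, Real.sqrt_sq ht.le, ht.ne']
  simpa [ContinuousAt, h0] using h

/-- The chain rule for a truncation of a continuous function that is `C¹` where positive: where `u`
vanishes, the truncation vanishes in a neighbourhood, whatever the (lack of) regularity of `u`. -/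
lemma hasFDerivAt_truncation_comp {Ω : Set (EuclideanSpace ℝ (Fin n))} (hΩ : IsOpen Ω)
    {u : EuclideanSpace ℝ (Fin n) → ℝ} (hu : ContinuousOn u Ω) (hu0 : ∀ x ∈ Ω, 0 ≤ u x)
    (hu1 : ∀ x ∈ positivitySet Ω u, ContDiffAt ℝ 1 u x) {δ : ℝ} (hδ : 0 < δ)
    {x : EuclideanSpace ℝ (Fin n)} (hx : x ∈ Ω) :
    HasFDerivAt (fun y => truncation δ (u y)) (truncationDeriv δ (u x) • fderiv ℝ u x) x := by
  rcases (hu0 x hx).eq_or_lt with h | h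
  · rw [truncationDeriv_of_le (by rw [← h]; exact hδ.le), zero_smul]
    refine (hasFDerivAt_const (0 : ℝ) x).congr_of_eventuallyEq ?_
    have hc : ContinuousAt u x := hu.continuousAt (hΩ.mem_nhds hx)
    filter_upwards [hc.eventually_lt_const (by rw [← h]; exact hδ : u x < δ)] with y hy
    exact truncation_of_le hδ hy.le
  · exact (hasDerivAt_truncation hδ (u x)).comp_hasFDerivAt x
      ((hu1 x ⟨hx, h⟩).differentiableAt (by simp)).hasFDerivAt

/-- The weak gradient vanishes almost everywhere on the contact set `{u = 0}`. -/
lemma IsH1LocWithGradient.ae_eq_zero {Ω : Set (EuclideanSpace ℝ (Fin n))} (hΩ : IsOpen Ω)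
    {u : EuclideanSpace ℝ (Fin n) → ℝ} (hu : ContinuousOn u Ω) (hu0 : ∀ x ∈ Ω, 0 ≤ u x)
    (hu1 : ∀ x ∈ positivitySet Ω u, ContDiffAt ℝ 1 u x)
    {g : EuclideanSpace ℝ (Fin n) → EuclideanSpace ℝ (Fin n)} (h : IsH1LocWithGradient Ω u g) :
    ∀ᵐ x, x ∈ Ω → x ∉ positivitySet Ω u → g x = 0 := by
  have hPo := isOpen_positivitySet hΩ hu
  have hgP := h.ae_eq_gradient hPo (positivitySet_subset Ω u) hu1
  have hgl : LocallyIntegrableOn g Ω :=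
    (locallyIntegrableOn_iff hΩ.isLocallyClosed).2 fun K hK hKc => h.integrableOn hKc hK
  have hgi : LocallyIntegrableOn ((positivitySet Ω u).indicator g) Ω :=
    (locallyIntegrableOn_iff hΩ.isLocallyClosed).2 fun K hK hKc =>
      (h.integrableOn hKc hK).indicator hPo.measurableSet
  have key := ae_eq_zero_of_forall_integral_inner_mul hΩ (hgl.sub hgi) fun φ hφ w => ?_
  · filter_upwards [key] with x hx hxΩ hxP
    simpa [sub_eq_zero, hxP] using hx hxΩ
  obtain ⟨h1, h2, h3⟩ := hφ
  have e1 := h.integral_by_parts φ ⟨h1, h2, h3⟩ w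
  rw [setIntegral_eq_integral_of_tsupport h3 fun x hx => by
      simp [fderiv_apply_eq_zero_of_notMem_tsupport hx],
    setIntegral_eq_integral_of_tsupport h3 fun x hx => by
      simp [image_eq_zero_of_notMem_tsupport hx]] at e1
  have hK : IntegrableOn (fun x => ⟪g x, w⟫) (tsupport φ) :=
    Integrable.inner_const (hgl.integrableOn_compact_subset h3 h2) w
  have hKi : IntegrableOn (fun x => ⟪(positivitySet Ω u).indicator g x, w⟫) (tsupport φ) :=
    Integrable.inner_const (hgi.integrableOn_compact_subset h3 h2) w
  have i1 := integrable_mul_of_integrableOn_tsupport h1.continuous h2 hK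
  have i2 := integrable_mul_of_integrableOn_tsupport h1.continuous h2 hKi
  have huc : ContinuousOn u (tsupport φ) := hu.mono h3
  have hdφ : Continuous (fun x => fderiv ℝ φ x w) :=
    (h1.continuous_fderiv (by simp)).clm_apply continuous_const
  have i3 : Integrable (fun x => u x * fderiv ℝ φ x w) := by
    refine ((huc.mul hdφ.continuousOn).integrableOn_compact
      h2).integrable_of_forall_notMem_eq_zero fun x hx => ?_
    simp [fderiv_apply_eq_zero_of_notMem_tsupport hx]
  -- The truncated functions satisfy the integration by parts formula classically.
  have hT (δ : ℝ) (hδ : 0 < δ) : Continuous (truncation δ) :=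
    continuous_iff_continuousAt.2 fun t => (hasDerivAt_truncation hδ t).continuousAt
  have hT' (δ : ℝ) (hδ : 0 < δ) : Continuous (truncationDeriv δ) := by
    unfold truncationDeriv
    refine Continuous.div (by fun_prop) (by fun_prop) fun t => ?_
    positivity
  have hae (δ : ℝ) (hδ : 0 < δ) :
      (fun x => (truncationDeriv δ (u x) • fderiv ℝ u x) w * φ x) =ᵐ[volume]
        fun x => truncationDeriv δ (u x) * (⟪(positivitySet Ω u).indicator g x, w⟫ * φ x) := by
    filter_upwards [hgP] with x hx
    by_cases hxs : x ∈ tsupport φ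
    · by_cases hxP : x ∈ positivitySet Ω u
      · simp [hxP, hx hxP, mul_assoc]
      · have hux : u x ≤ δ := le_trans (not_lt.1 fun hh => hxP ⟨h3 hxs, hh⟩) hδ.le
        simp [truncationDeriv_of_le hux]
    · simp [image_eq_zero_of_notMem_tsupport hxs]
  have j2 (δ : ℝ) (hδ : 0 < δ) : Integrable fun x =>
      truncationDeriv δ (u x) * (⟪(positivitySet Ω u).indicator g x, w⟫ * φ x) := by
    have hKi' : IntegrableOn (fun x => truncationDeriv δ (u x) *
        ⟪(positivitySet Ω u).indicator g x, w⟫) (tsupport φ) :=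
      hKi.continuousOn_mul ((hT' δ hδ).comp_continuousOn huc) h2
    simpa only [mul_assoc] using integrable_mul_of_integrableOn_tsupport h1.continuous h2 hKi'
  have j3 (δ : ℝ) (hδ : 0 < δ) : Integrable fun x => truncation δ (u x) * φ x :=
    integrable_mul_of_integrableOn_tsupport h1.continuous h2
      (((hT δ hδ).comp_continuousOn huc).integrableOn_compact h2)
  have j4 (δ : ℝ) (hδ : 0 < δ) : Integrable fun x => truncation δ (u x) * fderiv ℝ φ x w := by
    refine ((((hT δ hδ).comp_continuousOn huc).mul hdφ.continuousOn).integrableOn_compact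
      h2).integrable_of_forall_notMem_eq_zero fun x hx => ?_
    simp [fderiv_apply_eq_zero_of_notMem_tsupport hx]
  have ibp (δ : ℝ) (hδ : 0 < δ) : ∫ x, truncation δ (u x) * fderiv ℝ φ x w =
      - ∫ x, truncationDeriv δ (u x) * (⟪(positivitySet Ω u).indicator g x, w⟫ * φ x) := by
    have hd : ∀ x ∈ tsupport φ, HasFDerivAt (fun y => truncation δ (u y))
        (truncationDeriv δ (u x) • fderiv ℝ u x) x := fun x hx =>
      hasFDerivAt_truncation_comp hΩ hu hu0 hu1 hδ (h3 hx)
    have hpt : (fun x => fderiv ℝ (fun y => truncation δ (u y)) x w * φ x) =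
        fun x => (truncationDeriv δ (u x) • fderiv ℝ u x) w * φ x := by
      ext x
      by_cases hxs : x ∈ tsupport φ
      · rw [(hd x hxs).fderiv]
      · simp [image_eq_zero_of_notMem_tsupport hxs]
    rw [← integral_congr_ae (hae δ hδ), ← hpt]
    refine integral_mul_fderiv_eq_neg_fderiv_mul_of_integrable ?_ (j4 δ hδ) (j3 δ hδ)
      (fun x hx => (hd x hx).differentiableAt)
      (fun x _ => h1.contDiffAt.differentiableAt (by simp))
    rw [hpt]
    exact (j2 δ hδ).congr (hae δ hδ).symm
  have hδ0 : Tendsto (fun k : ℕ => 1 / ((k : ℝ) + 1)) atTop (𝓝 0) :=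
    tendsto_one_div_add_atTop_nhds_zero_nat
  have lim1 : Tendsto (fun k : ℕ => ∫ x, truncation (1 / ((k : ℝ) + 1)) (u x) * fderiv ℝ φ x w)
      atTop (𝓝 (∫ x, u x * fderiv ℝ φ x w)) := by
    refine tendsto_integral_of_dominated_convergence (fun x => ‖u x * fderiv ℝ φ x w‖)
      (fun k => (j4 _ (by positivity)).aestronglyMeasurable) i3.norm
      (fun k => Eventually.of_forall fun x => ?_) (Eventually.of_forall fun x => ?_)
    · by_cases hxs : x ∈ tsupport φ
      · rw [norm_mul, norm_mul]
        refine mul_le_mul_of_nonneg_right ?_ (norm_nonneg _)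
        rw [Real.norm_eq_abs, Real.norm_eq_abs, abs_of_nonneg (hu0 x (h3 hxs))]
        exact abs_truncation_le (by positivity) (hu0 x (h3 hxs))
      · simp [fderiv_apply_eq_zero_of_notMem_tsupport hxs]
    · by_cases hxs : x ∈ tsupport φ
      · have := (((continuous_truncation_left (u x)).tendsto 0).comp hδ0).mul_const
          (fderiv ℝ φ x w)
        rwa [truncation_zero (hu0 x (h3 hxs))] at this
      · simp [fderiv_apply_eq_zero_of_notMem_tsupport hxs]
  have lim2 : Tendsto (fun k : ℕ => ∫ x, truncationDeriv (1 / ((k : ℝ) + 1)) (u x) *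
        (⟪(positivitySet Ω u).indicator g x, w⟫ * φ x))
      atTop (𝓝 (∫ x, ⟪(positivitySet Ω u).indicator g x, w⟫ * φ x)) := by
    refine tendsto_integral_of_dominated_convergence
      (fun x => ‖⟪(positivitySet Ω u).indicator g x, w⟫ * φ x‖)
      (fun k => (j2 _ (by positivity)).aestronglyMeasurable) i2.norm
      (fun k => Eventually.of_forall fun x => ?_) (Eventually.of_forall fun x => ?_)
    · rw [norm_mul]
      exact mul_le_of_le_one_left (norm_nonneg _) (abs_truncationDeriv_le_one _ _)
    · by_cases hxP : x ∈ positivitySet Ω u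
      · simpa using ((tendsto_truncationDeriv hxP.2).comp hδ0).mul_const
          (⟪(positivitySet Ω u).indicator g x, w⟫ * φ x)
      · simp [hxP]
  have e2 := tendsto_nhds_unique lim1
    (lim2.neg.congr fun k => (ibp (1 / ((k : ℝ) + 1)) (by positivity)).symm)
  have e3 : ∫ x, ⟪(g - (positivitySet Ω u).indicator g) x, w⟫ * φ x
      = (∫ x, ⟪g x, w⟫ * φ x) - ∫ x, ⟪(positivitySet Ω u).indicator g x, w⟫ * φ x := by
    rw [← integral_sub i1 i2]
    congr 1; ext x
    rw [Pi.sub_apply, inner_sub_left, sub_mul]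
  rw [e3]; linarith

/-! ### The gradient of an axially symmetric function -/

/-- An axially symmetric function has vanishing derivative in the directions orthogonal both to the
axis and to the position: it is constant along the circle `t ↦ ⟪e, x⟫ e + cos t p + sin t w`. -/
lemma fderiv_eq_zero_of_axial {e : EuclideanSpace ℝ (Fin n)} (he : ‖e‖ = 1)
    {Ω : Set (EuclideanSpace ℝ (Fin n))} (hΩ : IsOpen Ω) {u : EuclideanSpace ℝ (Fin n) → ℝ}
    (hs : IsAxiallySymmetric e Ω u) {x : EuclideanSpace ℝ (Fin n)} (hx : x ∈ Ω)
    (hd : DifferentiableAt ℝ u x) {w : EuclideanSpace ℝ (Fin n)} (hew : ⟪e, w⟫ = 0)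
    (hpw : ⟪transversal e x, w⟫ = 0) (hnw : ‖w‖ = ‖transversal e x‖) : fderiv ℝ u x w = 0 := by
  obtain ⟨f, hf⟩ := hs
  set p := transversal e x with hp
  let c : ℝ → EuclideanSpace ℝ (Fin n) := fun t => ⟪e, x⟫ • e + (Real.cos t • p + Real.sin t • w)
  have hep : ⟪e, p⟫ = 0 := inner_transversal_self_left he x
  have hc0 : c 0 = x := by simp [c, hp, transversal]
  have hc : HasDerivAt c w 0 := by
    have h := ((Real.hasDerivAt_cos 0).smul_const p).add ((Real.hasDerivAt_sin 0).smul_const w)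
    refine (h.const_add (⟪e, x⟫ • e)).congr_deriv ?_
    simp
  have hin (t : ℝ) : ⟪e, c t⟫ = ⟪e, x⟫ := by
    simp [c, inner_add_right, inner_smul_right, hep, hew, he]
  have hax (t : ℝ) : axisDist e (c t) = axisDist e x := by
    have h1 : transversal e (c t) = Real.cos t • p + Real.sin t • w := by
      rw [transversal, hin]; simp [c]
    rw [axisDist, axisDist, h1, ← hp, ← sq_eq_sq₀ (norm_nonneg _) (norm_nonneg _),
      ← real_inner_self_eq_norm_sq]
    simp only [inner_add_left, inner_add_right, inner_smul_left, inner_smul_right, hpw,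
      real_inner_comm p w, real_inner_self_eq_norm_sq, hnw, RCLike.conj_to_real]
    linear_combination ‖p‖ ^ 2 * Real.sin_sq_add_cos_sq t
  have hcΩ : ∀ᶠ t in 𝓝 (0 : ℝ), c t ∈ Ω :=
    hc.continuousAt.eventually_mem (by rw [hc0]; exact hΩ.mem_nhds hx)
  have h1 : HasDerivAt (u ∘ c) (fderiv ℝ u x w) 0 := by
    have h := hd.hasFDerivAt
    rw [← hc0] at h
    have h2 := h.comp_hasDerivAt (0 : ℝ) hc
    rwa [hc0] at h2
  have h2 : HasDerivAt (u ∘ c) 0 0 := by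
    refine (hasDerivAt_const (0 : ℝ) (u x)).congr_of_eventuallyEq ?_
    filter_upwards [hcΩ] with t ht
    rw [Function.comp_apply, hf _ ht, hf _ hx, hax, hin]
  exact h1.unique h2

/-- Off the axis, the gradient of an axially symmetric function is a combination of the axis
direction and of the transversal component of the position. -/
lemma gradient_eq_of_axial {e : EuclideanSpace ℝ (Fin n)} (he : ‖e‖ = 1)
    {Ω : Set (EuclideanSpace ℝ (Fin n))} (hΩ : IsOpen Ω) {u : EuclideanSpace ℝ (Fin n) → ℝ}
    (hs : IsAxiallySymmetric e Ω u) {x : EuclideanSpace ℝ (Fin n)} (hx : x ∈ Ω)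
    (hd : DifferentiableAt ℝ u x) (hpx : transversal e x ≠ 0) :
    ∃ a b : ℝ, gradient u x = a • e + b • transversal e x := by
  set p := transversal e x with hp
  set q := gradient u x with hq
  have hep : ⟪e, p⟫ = 0 := inner_transversal_self_left he x
  have hnp : ‖p‖ ≠ 0 := norm_ne_zero_iff.2 hpx
  refine ⟨⟪e, q⟫, ⟪p, q⟫ / ‖p‖ ^ 2, ?_⟩
  set w := q - (⟪e, q⟫ • e + (⟪p, q⟫ / ‖p‖ ^ 2) • p) with hw
  have hew : ⟪e, w⟫ = 0 := by
    rw [hw, inner_sub_right, inner_add_right, inner_smul_right, inner_smul_right, hep,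
      real_inner_self_eq_norm_sq, he]
    ring
  have hpw : ⟪p, w⟫ = 0 := by
    rw [hw, inner_sub_right, inner_add_right, inner_smul_right, inner_smul_right,
      real_inner_comm e p, hep, real_inner_self_eq_norm_sq]
    field_simp
    ring
  have hqw : ⟪q, w⟫ = 0 := by
    by_cases hw0 : w = 0
    · rw [hw0, inner_zero_right]
    · have hnw : ‖w‖ ≠ 0 := norm_ne_zero_iff.2 hw0
      have h := fderiv_eq_zero_of_axial he hΩ hs hx hd (w := (‖p‖ / ‖w‖) • w)
        (by rw [inner_smul_right, hew, mul_zero]) (by rw [inner_smul_right, hpw, mul_zero])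
        (by rw [norm_smul, norm_div, norm_norm, norm_norm, div_mul_cancel₀ _ hnw])
      rw [map_smul, smul_eq_mul, ← inner_gradient_eq_fderiv] at h
      exact (mul_eq_zero.1 h).resolve_left (div_ne_zero hnp hnw)
  have hww : ⟪w, w⟫ = 0 := by
    conv_lhs => rw [hw]
    rw [inner_sub_left, inner_add_left, inner_smul_left, inner_smul_left, hqw, hew, hpw]
    simp
  exact sub_eq_zero.1 (inner_self_eq_zero.1 hww)

/-- The axis is a null set. -/
lemma ae_transversal_ne_zero (hn : 3 ≤ n) {e : EuclideanSpace ℝ (Fin n)} (he : ‖e‖ = 1) :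
    ∀ᵐ x : EuclideanSpace ℝ (Fin n), transversal e x ≠ 0 := by
  have h := Measure.addHaar_submodule (volume : Measure (EuclideanSpace ℝ (Fin n)))
    (LinearMap.ker (transversalCLM e : EuclideanSpace ℝ (Fin n) →ₗ[ℝ] EuclideanSpace ℝ (Fin n))) fun htop => by
      have h0 := trace_transversalCLM he
      rw [LinearMap.ker_eq_top.1 htop, map_zero] at h0
      have : (3 : ℝ) ≤ n := by exact_mod_cast hn
      linarith
  rw [ae_iff]
  convert! h using 2
  ext x; simp

/-- The density `u_τ²` on the positivity set, extended by zero. -/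
def derivTauSq (e : EuclideanSpace ℝ (Fin n)) (Ω : Set (EuclideanSpace ℝ (Fin n)))
    (u : EuclideanSpace ℝ (Fin n) → ℝ) : EuclideanSpace ℝ (Fin n) → ℝ :=
  (positivitySet Ω u).indicator fun x => derivTau e u x ^ 2

lemma derivTauSq_nonneg (e : EuclideanSpace ℝ (Fin n)) (Ω : Set (EuclideanSpace ℝ (Fin n)))
    (u : EuclideanSpace ℝ (Fin n) → ℝ) (x : EuclideanSpace ℝ (Fin n)) : 0 ≤ derivTauSq e Ω u x :=
  indicator_nonneg (fun _ _ => sq_nonneg _) x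

/-- The weak gradient of an axially symmetric `u` is almost everywhere spanned by the axis direction
and the transversal component of the position, and its component along the latter gives `u_τ²`. -/
lemma ae_weakGradient_eq (hn : 3 ≤ n) {e : EuclideanSpace ℝ (Fin n)} (he : ‖e‖ = 1)
    {Ω : Set (EuclideanSpace ℝ (Fin n))} (hΩ : IsOpen Ω) {u : EuclideanSpace ℝ (Fin n) → ℝ}
    (hu : ContinuousOn u Ω) (hu0 : ∀ x ∈ Ω, 0 ≤ u x)
    (hu1 : ∀ x ∈ positivitySet Ω u, ContDiffAt ℝ 1 u x) (hs : IsAxiallySymmetric e Ω u)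
    {g : EuclideanSpace ℝ (Fin n) → EuclideanSpace ℝ (Fin n)} (h : IsH1LocWithGradient Ω u g) :
    ∀ᵐ x, x ∈ Ω → ∃ a b : ℝ, g x = a • e + b • transversal e x ∧
      derivTauSq e Ω u x = b ^ 2 * ‖transversal e x‖ ^ 2 := by
  filter_upwards [ae_transversal_ne_zero hn he, h.ae_eq_zero hΩ hu hu0 hu1,
    h.ae_eq_gradient (isOpen_positivitySet hΩ hu) (positivitySet_subset Ω u) hu1]
    with x h1 h2 h3 hx
  by_cases hxP : x ∈ positivitySet Ω u
  · obtain ⟨a, b, hab⟩ := gradient_eq_of_axial he hΩ hs hx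
      ((hu1 x hxP).differentiableAt (by simp)) h1
    refine ⟨a, b, (h3 hxP).trans hab, ?_⟩
    have hn1 : ‖transversal e x‖ ≠ 0 := norm_ne_zero_iff.2 h1
    have : derivTau e u x = b * ‖transversal e x‖ := by
      rw [derivTau, ← inner_gradient_eq_fderiv, hab, inner_smul_right, inner_add_left,
        inner_smul_left, inner_smul_left, inner_transversal_self_left he,
        real_inner_self_eq_norm_sq, axisDist]
      rw [mul_zero, zero_add, conj_trivial, sq, mul_left_comm, inv_mul_cancel_left₀ hn1]
    rw [derivTauSq, indicator_of_mem hxP, this, mul_pow]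
  · exact ⟨0, 0, by rw [h2 hx hxP]; simp, by rw [derivTauSq, indicator_of_notMem hxP]; norm_num⟩

/-! ### The stability inequality along radial deformations -/

/-- A continuous function, quadratic in its second variable, becomes integrable on a compact set
when a square integrable field is inserted in that variable. -/
lemma integrableOn_of_quadratic {K : Set (EuclideanSpace ℝ (Fin n))} (hK : IsCompact K)
    {g : EuclideanSpace ℝ (Fin n) → EuclideanSpace ℝ (Fin n)} (hg : MemLp g 2 (volume.restrict K))
    {F : EuclideanSpace ℝ (Fin n) × EuclideanSpace ℝ (Fin n) → ℝ} (hF : Continuous F)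
    (hq : ∀ x v, ∀ c : ℝ, F (x, c • v) = c ^ 2 * F (x, v)) :
    IntegrableOn (fun x => F (x, g x)) K := by
  obtain ⟨C, hC⟩ := (hK.prod (isCompact_closedBall (0 : EuclideanSpace ℝ (Fin n)) 1)
    ).exists_bound_of_continuousOn hF.continuousOn
  have hb : ∀ x ∈ K, ∀ v, ‖F (x, v)‖ ≤ C * ‖v‖ ^ 2 := by
    intro x hx v
    by_cases hv : v = 0
    · have := hq x 0 0
      rw [smul_zero, zero_pow two_ne_zero, zero_mul] at this
      rw [hv, this]
      simp
    · have hnv : ‖v‖ ≠ 0 := norm_ne_zero_iff.2 hv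
      have h1 := hq x (‖v‖⁻¹ • v) ‖v‖
      rw [smul_smul, mul_inv_cancel₀ hnv, one_smul] at h1
      rw [h1, norm_mul, norm_pow, norm_norm, mul_comm]
      refine mul_le_mul_of_nonneg_right (hC (x, ‖v‖⁻¹ • v) ⟨hx, ?_⟩) (by positivity)
      simp [norm_smul, hnv]
  have hint : IntegrableOn (fun x => C * ‖g x‖ ^ 2) K :=
    (hg.integrable_norm_pow two_ne_zero).const_mul C
  refine Integrable.mono' hint
    (hF.comp_aestronglyMeasurable (aestronglyMeasurable_id.prodMk hg.1)) ?_
  exact (ae_restrict_iff' hK.measurableSet).2 (Eventually.of_forall fun x hx => hb x hx _)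

lemma derivTauSq_integrableOn (hn : 3 ≤ n) {e : EuclideanSpace ℝ (Fin n)} (he : ‖e‖ = 1)
    {Ω : Set (EuclideanSpace ℝ (Fin n))} (hΩ : IsOpen Ω) {u : EuclideanSpace ℝ (Fin n) → ℝ}
    (hu : ContinuousOn u Ω) (hu0 : ∀ x ∈ Ω, 0 ≤ u x)
    (hu1 : ∀ x ∈ positivitySet Ω u, ContDiffAt ℝ 1 u x) (hs : IsAxiallySymmetric e Ω u)
    {g : EuclideanSpace ℝ (Fin n) → EuclideanSpace ℝ (Fin n)} (h : IsH1LocWithGradient Ω u g)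
    {K : Set (EuclideanSpace ℝ (Fin n))} (hK : IsCompact K) (hKΩ : K ⊆ Ω) :
    IntegrableOn (derivTauSq e Ω u) K := by
  have hi : IntegrableOn (fun x => ‖transversal e (g x)‖ ^ 2) K :=
    integrableOn_of_quadratic hK (h.memLp_grad K hK hKΩ) (F := fun y => ‖transversal e y.2‖ ^ 2)
      ((((contDiff_transversal (k := 0) e).continuous.comp continuous_snd).norm).pow 2)
      fun x v c => by
        simp only
        rw [← transversalCLM_apply, map_smul, norm_smul, mul_pow, Real.norm_eq_abs, sq_abs,
          transversalCLM_apply]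
  refine hi.congr ((ae_restrict_iff' hK.measurableSet).2 ?_)
  filter_upwards [ae_weakGradient_eq hn he hΩ hu hu0 hu1 hs h] with x hx hxK
  obtain ⟨a, b, h1, h2⟩ := hx (hKΩ hxK)
  have : transversal e (g x) = b • transversal e x := by
    rw [h1, ← transversalCLM_apply, map_add, map_smul, map_smul, transversalCLM_apply,
      transversalCLM_apply, transversal_self he,
      transversal_of_inner_eq_zero (inner_transversal_self_left he x), smul_zero, zero_add]
  rw [h2, this, norm_smul, mul_pow, Real.norm_eq_abs, sq_abs]

/-- The quadratic form `τ² |∇ζ|² + 2 ζ ζ_p - (n - 3) ζ²`, with `p` the transversal component of the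
position; away from the axis it is `|∇(τ ζ)|² - (n - 2) ζ²`. -/
def radialForm (e : EuclideanSpace ℝ (Fin n)) (ζ : EuclideanSpace ℝ (Fin n) → ℝ)
    (x : EuclideanSpace ℝ (Fin n)) : ℝ :=
  axisDist e x ^ 2 * ‖fderiv ℝ ζ x‖ ^ 2 + 2 * ζ x * fderiv ℝ ζ x (transversal e x)
    - (n - 3) * ζ x ^ 2

lemma IsTest.smul_transversal {k : WithTop ℕ∞} (e : EuclideanSpace ℝ (Fin n))
    {Ω : Set (EuclideanSpace ℝ (Fin n))} {ζ : EuclideanSpace ℝ (Fin n) → ℝ} (hζ : IsTest k Ω ζ) :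
    IsTest k Ω (fun x => ζ x • transversal e x) :=
  ⟨hζ.1.smul (contDiff_transversal e), hζ.2.1.smul_right (f' := transversal e),
    (tsupport_smul_subset_left ζ (transversal e)).trans hζ.2.2⟩

lemma IsTest.sq {k : WithTop ℕ∞} {Ω : Set (EuclideanSpace ℝ (Fin n))}
    {ζ : EuclideanSpace ℝ (Fin n) → ℝ} (hζ : IsTest k Ω ζ) : IsTest k Ω (fun x => ζ x ^ 2) := by
  have h : (fun x => ζ x ^ 2) = ζ * ζ := by ext x; simp [pow_two]
  rw [h]
  exact ⟨hζ.1.mul hζ.1, hζ.2.1.mul_right, tsupport_mul_subset_left.trans hζ.2.2⟩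

/-- Stability along the smooth field `ζ p`, combined with criticality along `ζ² p`. The terms with
the energy density cancel pointwise, so nothing is needed about the free boundary. -/
lemma integral_radialForm_nonneg (hn : 3 ≤ n) {γ : ℝ} {e : EuclideanSpace ℝ (Fin n)} (he : ‖e‖ = 1)
    {Ω : Set (EuclideanSpace ℝ (Fin n))} (hΩ : IsOpen Ω) {u : EuclideanSpace ℝ (Fin n) → ℝ}
    (hu : ContinuousOn u Ω) (hu0 : ∀ x ∈ Ω, 0 ≤ u x)
    (hu1 : ∀ x ∈ positivitySet Ω u, ContDiffAt ℝ 1 u x) (hs : IsAxiallySymmetric e Ω u)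
    {g : EuclideanSpace ℝ (Fin n) → EuclideanSpace ℝ (Fin n)} (h : IsH1LocWithGradient Ω u g)
    (hst : ∀ Φ : EuclideanSpace ℝ (Fin n) → EuclideanSpace ℝ (Fin n), IsTest ∞ Ω Φ →
      firstVariation γ Ω u g Φ = 0 ∧ 0 ≤ secondVariation γ Ω u g Φ)
    {ζ : EuclideanSpace ℝ (Fin n) → ℝ} (hζ : IsTest ∞ Ω ζ) :
    0 ≤ ∫ x, derivTauSq e Ω u x * radialForm e ζ x := by
  set Φ := fun x => ζ x • transversal e x with hΦ
  set Ψ := fun x => ζ x ^ 2 • transversal e x with hΨ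
  have tΦ : IsTest ∞ Ω Φ := hζ.smul_transversal e
  have tΨ : IsTest ∞ Ω Ψ := hζ.sq.smul_transversal e
  have h2 := (hst Φ tΦ).2
  have h1 := (hst Ψ tΨ).1
  have hζd (x) : DifferentiableAt ℝ ζ x := hζ.1.contDiffAt.differentiableAt (by simp)
  have dΦ (x) : fderiv ℝ Φ x = radialDifferential e (transversal e x) (gradient ζ x) (ζ x) :=
    fderiv_smul_transversal e (hζd x)
  have dΨ (x) : fderiv ℝ Ψ x =
      radialDifferential e (transversal e x) ((2 * ζ x) • gradient ζ x) (ζ x ^ 2) := by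
    rw [← gradient_sq (hζd x)]
    exact fderiv_smul_transversal e ((hζd x).pow 2)
  have divΦ (x) : divergence Φ x = ⟪gradient ζ x, transversal e x⟫ + ζ x * (n - 1) := by
    rw [divergence, dΦ, trace_radialDifferential he]
  have hen (x) : (divergence Φ x ^ 2 - traceSq Φ x) / 2 = ((n : ℝ) - 2) / 2 * divergence Ψ x := by
    rw [divΦ, traceSq, divergence, dΦ, dΨ, trace_radialDifferential he,
      trace_radialDifferential_comp_self he (inner_transversal_self_left he x), inner_smul_left]
    simp only [RCLike.conj_to_real]
    ring
  have cΦ : Continuous (fderiv ℝ Φ) := tΦ.1.continuous_fderiv (by simp)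
  have cΨ : Continuous (fderiv ℝ Ψ) := tΨ.1.continuous_fderiv (by simp)
  have cdiv : Continuous (divergence Φ) := by
    have : divergence Φ = fun x => fderiv ℝ ζ x (transversal e x) + ζ x * (n - 1) := by
      ext x; rw [divΦ, inner_gradient_eq_fderiv]
    rw [this]
    exact ((hζ.1.continuous_fderiv (by simp)).clm_apply (contDiff_transversal (k := 0) e).continuous
      ).add (hζ.1.continuous.mul continuous_const)
  have mK {Θ : EuclideanSpace ℝ (Fin n) → EuclideanSpace ℝ (Fin n)} (hΘ : IsTest ∞ Ω Θ) :
      MemLp g 2 (volume.restrict (tsupport Θ)) := h.memLp_grad _ hΘ.2.1 hΘ.2.2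
  have z0 {Θ : EuclideanSpace ℝ (Fin n) → EuclideanSpace ℝ (Fin n)} {x} (hx : x ∉ tsupport Θ) :
      fderiv ℝ Θ x = 0 :=
    image_eq_zero_of_notMem_tsupport fun h => hx (tsupport_fderiv_subset ℝ h)
  have iA : Integrable fun x => ‖ContinuousLinearMap.adjoint (fderiv ℝ Φ x) (g x)‖ ^ 2 := by
    refine (integrableOn_of_quadratic tΦ.2.1 (mK tΦ)
      (F := fun y => ‖ContinuousLinearMap.adjoint (fderiv ℝ Φ y.1) y.2‖ ^ 2) ?_
      ?_).integrable_of_forall_notMem_eq_zero fun x hx => by simp [z0 hx]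
    · exact (((ContinuousLinearMap.adjoint.continuous.comp
        (cΦ.comp continuous_fst)).clm_apply continuous_snd).norm).pow 2
    · intro x v c
      simp only [map_smul, norm_smul, mul_pow, Real.norm_eq_abs, sq_abs]
  have iB : Integrable fun x => 2 * ⟪g x, fderiv ℝ Φ x (fderiv ℝ Φ x (g x))⟫
      - 2 * ⟪g x, fderiv ℝ Φ x (g x)⟫ * divergence Φ x := by
    refine (integrableOn_of_quadratic tΦ.2.1 (mK tΦ)
      (F := fun y => 2 * ⟪y.2, fderiv ℝ Φ y.1 (fderiv ℝ Φ y.1 y.2)⟫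
        - 2 * ⟪y.2, fderiv ℝ Φ y.1 y.2⟫ * divergence Φ y.1) ?_
      ?_).integrable_of_forall_notMem_eq_zero fun x hx => by simp [z0 hx]
    · have c1 := cΦ.comp (continuous_fst (X := EuclideanSpace ℝ (Fin n))
        (Y := EuclideanSpace ℝ (Fin n)))
      have c2 := c1.clm_apply continuous_snd
      exact ((continuous_const.mul (continuous_snd.inner (c1.clm_apply c2))).sub
        ((continuous_const.mul (continuous_snd.inner c2)).mul (cdiv.comp continuous_fst)))
    · intro x v c
      simp only [map_smul, inner_smul_left, inner_smul_right, RCLike.conj_to_real]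
      ring
  have iC : Integrable fun x => ⟪g x, fderiv ℝ Ψ x (g x)⟫ := by
    refine (integrableOn_of_quadratic tΨ.2.1 (mK tΨ)
      (F := fun y => ⟪y.2, fderiv ℝ Ψ y.1 y.2⟫) ?_
      ?_).integrable_of_forall_notMem_eq_zero fun x hx => by simp [z0 hx]
    · exact continuous_snd.inner ((cΨ.comp continuous_fst).clm_apply continuous_snd)
    · intro x v c
      simp only [map_smul, inner_smul_left, inner_smul_right, RCLike.conj_to_real]
      ring
  have hE : ∫ x in Ω, energyDensity γ u g x * ((divergence Φ x ^ 2 - traceSq Φ x) / 2)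
      = (n - 2) * ∫ x in Ω, ⟪g x, fderiv ℝ Ψ x (g x)⟫ := by
    have : ∀ x, energyDensity γ u g x * ((divergence Φ x ^ 2 - traceSq Φ x) / 2)
        = ((n : ℝ) - 2) / 2 * (energyDensity γ u g x * divergence Ψ x) := fun x => by
      rw [hen]; ring
    simp_rw [this]
    rw [integral_const_mul]
    rw [firstVariation] at h1
    linear_combination ((n : ℝ) - 2) / 2 * h1
  have iCA : Integrable fun x => ((n : ℝ) - 2) * ⟪g x, fderiv ℝ Ψ x (g x)⟫
      + ‖ContinuousLinearMap.adjoint (fderiv ℝ Φ x) (g x)‖ ^ 2 := (iC.const_mul _).add iA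
  rw [secondVariation, hE, ← integral_const_mul, ← integral_add (iC.const_mul _).restrict
    iA.restrict, ← integral_add iCA.restrict iB.restrict] at h2
  refine h2.trans_eq ?_
  rw [← setIntegral_eq_integral_of_forall_compl_eq_zero (s := Ω)
    (f := fun x => derivTauSq e Ω u x * radialForm e ζ x)]
  · refine setIntegral_congr_ae hΩ.measurableSet ?_
    filter_upwards [ae_weakGradient_eq hn he hΩ hu hu0 hu1 hs h] with x hx hxΩ
    obtain ⟨a, b, hg, hm⟩ := hx hxΩ
    have id := variation_integrand_identity he (inner_transversal_self_left he x) (gradient ζ x)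
      (ζ x) a b (g x) hg
    rw [dΦ, dΨ, divΦ, hm, radialForm, axisDist, ← norm_gradient, ← inner_gradient_eq_fderiv, ← id]
    ring
  · intro x hx
    rw [derivTauSq, indicator_of_notMem fun hP => hx hP.1, zero_mul]

/-! ### Passage to test functions of class `C¹` -/

/-- A `C¹` test function is the limit of smooth ones, together with its differential, boundedly and
with supports in a fixed compact set. -/
lemma IsTest.exists_smooth_approx {Ω : Set (EuclideanSpace ℝ (Fin n))} (hΩ : IsOpen Ω)
    {ζ : EuclideanSpace ℝ (Fin n) → ℝ} (hζ : IsTest 1 Ω ζ) :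
    ∃ (K : Set (EuclideanSpace ℝ (Fin n))) (ζs : ℕ → EuclideanSpace ℝ (Fin n) → ℝ) (C : ℝ),
      IsCompact K ∧ K ⊆ Ω ∧ (∀ j, IsTest ∞ Ω (ζs j) ∧ tsupport (ζs j) ⊆ K) ∧
      (∀ j x, ‖ζs j x‖ ≤ C ∧ ‖fderiv ℝ (ζs j) x‖ ≤ C) ∧
      ∀ x, Tendsto (fun j => ζs j x) atTop (𝓝 (ζ x)) ∧
        Tendsto (fun j => fderiv ℝ (ζs j) x) atTop (𝓝 (fderiv ℝ ζ x)) := by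
  obtain ⟨h1, h2, h3⟩ := hζ
  obtain ⟨δ, hδ, hδΩ⟩ := IsCompact.exists_cthickening_subset_open h2 hΩ h3
  have hdc : Continuous (fderiv ℝ ζ) := h1.continuous_fderiv (by simp)
  obtain ⟨C₁, hC₁⟩ := h2.exists_bound_of_continuous h1.continuous
  obtain ⟨C₂, hC₂⟩ := (h2.fderiv ℝ).exists_bound_of_continuous hdc
  let φ : ℕ → ContDiffBump (0 : EuclideanSpace ℝ (Fin n)) := fun j =>
    ⟨δ / (j + 1) / 2, δ / (j + 1), by positivity, half_lt_self (by positivity)⟩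
  have hφ0 : Tendsto (fun j => (φ j).rOut) atTop (𝓝 0) := by
    have := tendsto_one_div_add_atTop_nhds_zero_nat (𝕜 := ℝ).const_mul δ
    simpa [φ, div_eq_mul_inv] using this
  have hφδ (j) : (φ j).rOut ≤ δ := div_le_self hδ.le (by simp)
  let ζs : ℕ → EuclideanSpace ℝ (Fin n) → ℝ := fun j =>
    MeasureTheory.convolution ((φ j).normed volume) ζ (ContinuousLinearMap.lsmul ℝ ℝ) volume
  have hd (j x) : fderiv ℝ (ζs j) x = MeasureTheory.convolution ((φ j).normed volume)
      (fderiv ℝ ζ) (ContinuousLinearMap.lsmul ℝ ℝ) volume x := by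
    rw [(h2.hasFDerivAt_convolution_right (ContinuousLinearMap.lsmul ℝ ℝ)
      (φ j).continuous_normed.locallyIntegrable h1 x).fderiv]
    rfl
  have hK : IsCompact (Metric.cthickening δ (tsupport ζ)) := h2.cthickening
  have hsupp (j) : tsupport (ζs j) ⊆ Metric.cthickening δ (tsupport ζ) := by
    refine closure_minimal ?_ Metric.isClosed_cthickening
    refine (support_convolution_subset _).trans ?_
    rw [(φ j).support_normed_eq]
    rintro _ ⟨a, ha, b, hb, rfl⟩
    refine Metric.mem_cthickening_of_dist_le _ b _ _ (subset_tsupport ζ hb) ?_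
    have : ‖a‖ < (φ j).rOut := by simpa using ha
    simpa using this.le.trans (hφδ j)
  have hbound {F : Type} [NormedAddCommGroup F] [NormedSpace ℝ F] [CompleteSpace F]
      {f : EuclideanSpace ℝ (Fin n) → F} (hf : Continuous f) {C : ℝ} (hC : ∀ x, ‖f x‖ ≤ C)
      (j x) : ‖MeasureTheory.convolution ((φ j).normed volume) f
        (ContinuousLinearMap.lsmul ℝ ℝ) volume x‖ ≤ C := by
    rw [← dist_zero_right]
    exact dist_convolution_le ((norm_nonneg _).trans (hC 0)) (φ j).support_normed_eq.subset
      (φ j).nonneg_normed (φ j).integral_normed hf.aestronglyMeasurable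
      fun y _ => by simpa using hC y
  refine ⟨_, ζs, max C₁ C₂, hK, hδΩ, fun j => ⟨⟨?_, ?_, (hsupp j).trans hδΩ⟩, hsupp j⟩, ?_, ?_⟩
  · exact (φ j).hasCompactSupport_normed.contDiff_convolution_left _ (φ j).contDiff_normed
      h1.continuous.locallyIntegrable
  · exact hK.of_isClosed_subset (isClosed_tsupport _) (hsupp j)
  · refine fun j x => ⟨(hbound h1.continuous hC₁ j x).trans (le_max_left _ _), ?_⟩
    rw [hd]
    exact (hbound hdc hC₂ j x).trans (le_max_right _ _)
  · refine fun x => ⟨ContDiffBump.convolution_tendsto_right_of_continuous hφ0 h1.continuous x, ?_⟩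
    simp_rw [hd]
    exact ContDiffBump.convolution_tendsto_right_of_continuous hφ0 hdc x

lemma continuous_axisDist (e : EuclideanSpace ℝ (Fin n)) : Continuous (axisDist e) :=
  (contDiff_transversal (k := 0) e).continuous.norm

lemma continuous_radialForm (e : EuclideanSpace ℝ (Fin n)) {ζ : EuclideanSpace ℝ (Fin n) → ℝ}
    (hζ : ContDiff ℝ 1 ζ) : Continuous (radialForm e ζ) := by
  have hd : Continuous (fderiv ℝ ζ) := hζ.continuous_fderiv (by simp)
  have hT : Continuous (transversal e) := (contDiff_transversal (k := 0) e).continuous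
  exact ((((continuous_axisDist e).pow 2).mul (hd.norm.pow 2)).add
    ((continuous_const.mul hζ.continuous).mul (hd.clm_apply hT))).sub
    (continuous_const.mul (hζ.continuous.pow 2))

lemma radialForm_eq_zero_of_notMem_tsupport (e : EuclideanSpace ℝ (Fin n))
    {ζ : EuclideanSpace ℝ (Fin n) → ℝ} {x : EuclideanSpace ℝ (Fin n)} (hx : x ∉ tsupport ζ) :
    radialForm e ζ x = 0 := by
  simp [radialForm, fderiv_apply_eq_zero_of_notMem_tsupport hx, image_eq_zero_of_notMem_tsupport hx]

lemma abs_radialForm_le (hn : 3 ≤ n) (e : EuclideanSpace ℝ (Fin n))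
    {ζ : EuclideanSpace ℝ (Fin n) → ℝ} {x : EuclideanSpace ℝ (Fin n)} {C R : ℝ}
    (h0 : ‖ζ x‖ ≤ C) (h1 : ‖fderiv ℝ ζ x‖ ≤ C) (hR : axisDist e x ≤ R) :
    |radialForm e ζ x| ≤ R ^ 2 * C ^ 2 + 2 * C * (C * R) + (n - 3) * C ^ 2 := by
  have hn' : (0 : ℝ) ≤ n - 3 := by
    have : (3 : ℝ) ≤ n := by exact_mod_cast hn
    linarith
  have hC : 0 ≤ C := (norm_nonneg _).trans h0
  have hτ : 0 ≤ axisDist e x := norm_nonneg _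
  have h2 : |fderiv ℝ ζ x (transversal e x)| ≤ C * R :=
    ((fderiv ℝ ζ x).le_opNorm _).trans (mul_le_mul h1 hR hτ hC)
  unfold radialForm
  refine (abs_sub _ _).trans (add_le_add ((abs_add_le _ _).trans (add_le_add ?_ ?_)) ?_)
  · rw [abs_of_nonneg (by positivity)]
    gcongr
  · rw [abs_mul, abs_mul, abs_two]
    have h0' : |ζ x| ≤ C := h0
    gcongr
  · rw [abs_mul, abs_of_nonneg hn', abs_of_nonneg (sq_nonneg _), ← sq_abs]
    have h0' : |ζ x| ≤ C := h0
    gcongr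

/-- A continuous function supported in `K` is integrable against a density integrable on `K`. -/
lemma integrable_mul_of_eq_zero_off {K : Set (EuclideanSpace ℝ (Fin n))} (hK : IsCompact K)
    {m F : EuclideanSpace ℝ (Fin n) → ℝ} (hm : IntegrableOn m K) (hF : Continuous F)
    (h0 : ∀ x ∉ K, F x = 0) : Integrable fun x => m x * F x :=
  (hm.mul_continuousOn hF.continuousOn hK).integrable_of_forall_notMem_eq_zero
    fun x hx => by simp [h0 x hx]

/-- Nonnegativity of the weighted radial form passes from smooth to `C¹` test functions. -/
lemma integral_radialForm_nonneg_of_smooth (hn : 3 ≤ n) (e : EuclideanSpace ℝ (Fin n))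
    {Ω : Set (EuclideanSpace ℝ (Fin n))} (hΩ : IsOpen Ω) {m : EuclideanSpace ℝ (Fin n) → ℝ}
    (hm : ∀ K, IsCompact K → K ⊆ Ω → IntegrableOn m K)
    (h : ∀ ζ, IsTest ∞ Ω ζ → 0 ≤ ∫ x, m x * radialForm e ζ x)
    {ζ : EuclideanSpace ℝ (Fin n) → ℝ} (hζ : IsTest 1 Ω ζ) :
    0 ≤ ∫ x, m x * radialForm e ζ x := by
  obtain ⟨K, ζs, C, hK, hKΩ, ht, hb, hlim⟩ := hζ.exists_smooth_approx hΩ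
  obtain ⟨R, hR⟩ := hK.exists_bound_of_continuousOn (continuous_axisDist e).continuousOn
  have hz (j) : ∀ x ∉ K, radialForm e (ζs j) x = 0 := fun x hx =>
    radialForm_eq_zero_of_notMem_tsupport e fun h => hx ((ht j).2 h)
  set D := R ^ 2 * C ^ 2 + 2 * C * (C * R) + (n - 3) * C ^ 2 with hD
  have hlim' : Tendsto (fun j => ∫ x, m x * radialForm e (ζs j) x) atTop
      (𝓝 (∫ x, m x * radialForm e ζ x)) := by
    refine tendsto_integral_of_dominated_convergence (K.indicator fun x => ‖m x‖ * D) (fun j => ?_)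
      ?_ (fun j => Eventually.of_forall fun x => ?_) (Eventually.of_forall fun x => ?_)
    · exact (integrable_mul_of_eq_zero_off hK (hm K hK hKΩ)
        (continuous_radialForm e ((ht j).1.1.of_le (by exact_mod_cast le_top)))
        (hz j)).aestronglyMeasurable
    · exact (integrable_indicator_iff hK.measurableSet).2 ((hm K hK hKΩ).norm.mul_const D)
    · by_cases hx : x ∈ K
      · rw [indicator_of_mem hx, norm_mul]
        refine mul_le_mul_of_nonneg_left ?_ (norm_nonneg _)
        exact abs_radialForm_le hn e (hb j x).1 (hb j x).2 ((le_abs_self _).trans (hR x hx))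
      · simp [hz j x hx, hx]
    · obtain ⟨l1, l2⟩ := hlim x
      have l3 : Tendsto (fun j => fderiv ℝ (ζs j) x (transversal e x)) atTop
          (𝓝 (fderiv ℝ ζ x (transversal e x))) :=
        ((ContinuousLinearMap.apply ℝ ℝ (transversal e x)).continuous.tendsto _).comp l2
      exact ((((l2.norm.pow 2).const_mul _).add ((l1.const_mul 2).mul l3)).sub
        ((l1.pow 2).const_mul _)).const_mul _
  exact ge_of_tendsto' hlim' fun j => h _ (ht j).1

/-! ### The regularized test function -/

/-- The regularization `(τ² + ε²)^{-1/2}` of the inverse distance to the axis. -/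
def regInv (ε : ℝ) (e x : EuclideanSpace ℝ (Fin n)) : ℝ := (√(axisDist e x ^ 2 + ε ^ 2))⁻¹

lemma regInv_sq (ε : ℝ) (e x : EuclideanSpace ℝ (Fin n)) :
    regInv ε e x ^ 2 = (axisDist e x ^ 2 + ε ^ 2)⁻¹ := by
  rw [regInv, inv_pow, Real.sq_sqrt (by positivity)]

lemma contDiff_regInv {ε : ℝ} (hε : 0 < ε) (e : EuclideanSpace ℝ (Fin n)) :
    ContDiff ℝ 1 (regInv ε e) := by
  have h : ContDiff ℝ 1 fun x => axisDist e x ^ 2 + ε ^ 2 :=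
    ((contDiff_transversal e).norm_sq ℝ).add contDiff_const
  exact (h.sqrt fun x => by positivity).inv fun x => by positivity

lemma gradient_regInv {ε : ℝ} (hε : 0 < ε) {e : EuclideanSpace ℝ (Fin n)} (he : ‖e‖ = 1)
    (x : EuclideanSpace ℝ (Fin n)) :
    gradient (regInv ε e) x = (-regInv ε e x ^ 3) • transversal e x := by
  have hT := hasFDerivAt_transversal e x
  have hpos : 0 < axisDist e x ^ 2 + ε ^ 2 := by positivity
  have h1 : HasFDerivAt (fun x => axisDist e x ^ 2 + ε ^ 2)
      (2 • (innerSL ℝ (transversal e x)).comp (transversalCLM e)) x := hT.norm_sq.add_const _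
  have h2 := (hasDerivAt_inv (Real.sqrt_pos.2 hpos).ne').comp_hasFDerivAt x (h1.sqrt hpos.ne')
  refine ext_inner_right ℝ fun w => ?_
  rw [inner_gradient_eq_fderiv, show regInv ε e = Inv.inv ∘ fun y => √(axisDist e y ^ 2 + ε ^ 2)
    from rfl, h2.fderiv]
  have hs : √(axisDist e x ^ 2 + ε ^ 2) ≠ 0 := (Real.sqrt_pos.2 hpos).ne'
  have h3 : ⟪transversal e x, transversal e w⟫ = ⟪transversal e x, w⟫ := by
    rw [← inner_transversal_left,
      transversal_of_inner_eq_zero (inner_transversal_self_left he x)]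
  simp only [_root_.smul_apply, ContinuousLinearMap.comp_apply, innerSL_apply_apply,
    transversalCLM_apply, h3, inner_smul_left, conj_trivial, Function.comp_apply, smul_eq_mul,
    nsmul_eq_mul]
  field_simp
  simp

lemma gradient_mul {η h : EuclideanSpace ℝ (Fin n) → ℝ} {x : EuclideanSpace ℝ (Fin n)}
    (hη : DifferentiableAt ℝ η x) (hh : DifferentiableAt ℝ h x) :
    gradient (fun y => η y * h y) x = η x • gradient h x + h x • gradient η x := by
  refine ext_inner_right ℝ fun w => ?_
  rw [inner_gradient_eq_fderiv, fderiv_fun_mul hη hh, inner_add_left, inner_smul_left,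
    inner_smul_left, inner_gradient_eq_fderiv, inner_gradient_eq_fderiv]
  simp

/-- The radial form of `ζ = η (τ² + ε²)^{-1/2}`, in terms of `r = τ² / (τ² + ε²)`. -/
lemma radialForm_mul_regInv {ε : ℝ} (hε : 0 < ε) {e : EuclideanSpace ℝ (Fin n)} (he : ‖e‖ = 1)
    {η : EuclideanSpace ℝ (Fin n) → ℝ} {x : EuclideanSpace ℝ (Fin n)}
    (hη : DifferentiableAt ℝ η x) {r : ℝ} (hr : r = axisDist e x ^ 2 * regInv ε e x ^ 2) :
    radialForm e (fun y => η y * regInv ε e y) x =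
      r * ‖fderiv ℝ η x‖ ^ 2
        + 2 * η x * fderiv ℝ η x (transversal e x) * regInv ε e x ^ 2 * (1 - r)
        - η x ^ 2 * regInv ε e x ^ 2 * ((n - 2) - (1 - r) ^ 2) := by
  have hh : DifferentiableAt ℝ (regInv ε e) x :=
    (contDiff_regInv hε e).contDiffAt.differentiableAt (by simp)
  have hN : ‖gradient (fun y => η y * regInv ε e y) x‖ ^ 2 =
      regInv ε e x ^ 2 * ‖fderiv ℝ η x‖ ^ 2
        - 2 * η x * regInv ε e x ^ 4 * fderiv ℝ η x (transversal e x)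
        + η x ^ 2 * regInv ε e x ^ 6 * axisDist e x ^ 2 := by
    rw [gradient_mul hη hh, gradient_regInv hε he, ← real_inner_self_eq_norm_sq, ← norm_gradient,
      ← inner_gradient_eq_fderiv, axisDist, ← real_inner_self_eq_norm_sq (gradient η x),
      ← real_inner_self_eq_norm_sq (transversal e x)]
    simp only [inner_add_left, inner_add_right, inner_smul_left, inner_smul_right, conj_trivial,
      real_inner_comm (transversal e x) (gradient η x)]
    ring
  have hI : fderiv ℝ (fun y => η y * regInv ε e y) x (transversal e x) =
      regInv ε e x * fderiv ℝ η x (transversal e x)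
        - η x * regInv ε e x ^ 3 * axisDist e x ^ 2 := by
    rw [← inner_gradient_eq_fderiv, gradient_mul hη hh, gradient_regInv hε he,
      inner_add_left, inner_smul_left, inner_smul_left, inner_smul_left, inner_gradient_eq_fderiv,
      real_inner_self_eq_norm_sq, axisDist]
    simp only [conj_trivial]
    ring
  rw [radialForm, ← norm_gradient, hN, hI, hr]
  ring

/-- Young's inequality absorbs the mixed term of the radial form of `η (τ² + ε²)^{-1/2}`: this works
even for `n = 3`, as both `1 - (1 - r)²` and the mixed term degenerate on the axis. -/
lemma radialForm_mul_regInv_le (hn : 3 ≤ n) {ε : ℝ} (hε : 0 < ε) {e : EuclideanSpace ℝ (Fin n)}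
    (he : ‖e‖ = 1) {η : EuclideanSpace ℝ (Fin n) → ℝ} {x : EuclideanSpace ℝ (Fin n)}
    (hη : DifferentiableAt ℝ η x) {r θ : ℝ} (hr : r = axisDist e x ^ 2 * regInv ε e x ^ 2)
    (hθ : 0 < θ) :
    radialForm e (fun y => η y * regInv ε e y) x ≤
      ‖fderiv ℝ η x‖ ^ 2 * (r + (1 - r) ^ 2 / θ)
        - (n - 2) * (1 - θ) * (η x ^ 2 * (r * regInv ε e x ^ 2)) := by
  rw [radialForm_mul_regInv hε he hη hr]
  set H := regInv ε e x with hH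
  set N := ‖fderiv ℝ η x‖ with hN
  set τ := axisDist e x with hτ
  have hr0 : 0 ≤ r := by rw [hr]; positivity
  have hr1 : r ≤ 1 := by
    rw [hr, regInv_sq, ← div_eq_mul_inv]
    exact div_le_one_of_le₀ (by nlinarith [sq_nonneg ε]) (by positivity)
  have hH0 : 0 ≤ H := by rw [hH, regInv]; positivity
  have hp : |fderiv ℝ η x (transversal e x)| ≤ N * τ := (fderiv ℝ η x).le_opNorm _
  have hmix : 2 * η x * fderiv ℝ η x (transversal e x) * H ^ 2 * (1 - r) ≤
      θ * (η x ^ 2 * (r * H ^ 2)) + N ^ 2 * ((1 - r) ^ 2 / θ) := by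
    have h1 : 2 * η x * fderiv ℝ η x (transversal e x) * H ^ 2 * (1 - r) ≤
        2 * (|η x| * H * (τ * H)) * (N * (1 - r)) := by
      have h2 : η x * fderiv ℝ η x (transversal e x) ≤ |η x| * (N * τ) :=
        (le_abs_self _).trans (by rw [abs_mul]; gcongr)
      have h3 : 0 ≤ 2 * H ^ 2 * (1 - r) := by
        have := sub_nonneg.2 hr1
        positivity
      nlinarith [mul_le_mul_of_nonneg_right h2 h3]
    have h4 : η x ^ 2 * (r * H ^ 2) = (|η x| * H * (τ * H)) ^ 2 := by
      rw [hr, mul_pow, mul_pow, sq_abs]; ring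
    rw [h4]
    refine h1.trans ?_
    have h5 : N ^ 2 * ((1 - r) ^ 2 / θ) = (N * (1 - r)) ^ 2 / θ := by ring
    rw [h5, ← sub_nonneg]
    have h6 : θ * (|η x| * H * (τ * H)) ^ 2 + (N * (1 - r)) ^ 2 / θ
        - 2 * (|η x| * H * (τ * H)) * (N * (1 - r))
        = (θ * (|η x| * H * (τ * H)) - N * (1 - r)) ^ 2 / θ := by
      field_simp
      ring
    rw [h6]
    positivity
  have hk : (1 : ℝ) ≤ n - 2 := by
    have : (3 : ℝ) ≤ n := by exact_mod_cast hn
    linarith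
  have hgap : (n - 2 : ℝ) * (1 - θ) * r + θ * r ≤ (n - 2) - (1 - r) ^ 2 := by
    nlinarith [mul_nonneg (mul_nonneg hθ.le hr0) (sub_nonneg.2 hk),
      mul_nonneg (sub_nonneg.2 hr1) (sub_nonneg.2 hk), mul_nonneg (sub_nonneg.2 hr1) hr0]
  have hA : 0 ≤ η x ^ 2 * H ^ 2 := by positivity
  nlinarith [mul_le_mul_of_nonneg_left hgap hA]

/-! ### Removal of the regularization -/

/-- Fatou's lemma for integrals bounded by a convergent sequence. -/
lemma integrable_and_integral_le_of_tendsto {X : Type*} [MeasurableSpace X] {μ : Measure X}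
    {F : ℕ → X → ℝ} {f : X → ℝ} {c : ℕ → ℝ} {c₀ : ℝ} (hF : ∀ j, Integrable (F j) μ)
    (hF0 : ∀ j x, 0 ≤ F j x) (hf0 : ∀ x, 0 ≤ f x)
    (hlim : ∀ᵐ x ∂μ, Tendsto (fun j => F j x) atTop (𝓝 (f x)))
    (hc : Tendsto c atTop (𝓝 c₀)) (hle : ∀ j, ∫ x, F j x ∂μ ≤ c j) :
    Integrable f μ ∧ ∫ x, f x ∂μ ≤ c₀ := by
  have hm : AEStronglyMeasurable f μ :=
    aestronglyMeasurable_of_tendsto_ae atTop (fun j => (hF j).aestronglyMeasurable) hlim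
  have hle' : ∫⁻ x, ENNReal.ofReal (f x) ∂μ ≤ ENNReal.ofReal c₀ := by
    calc ∫⁻ x, ENNReal.ofReal (f x) ∂μ
        = ∫⁻ x, liminf (fun j => ENNReal.ofReal (F j x)) atTop ∂μ := by
          refine lintegral_congr_ae ?_
          filter_upwards [hlim] with x hx
          exact ((ENNReal.continuous_ofReal.tendsto _).comp hx).liminf_eq.symm
      _ ≤ liminf (fun j => ∫⁻ x, ENNReal.ofReal (F j x) ∂μ) atTop :=
          lintegral_liminf_le' fun j => (hF j).aestronglyMeasurable.aemeasurable.ennreal_ofReal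
      _ ≤ liminf (fun j => ENNReal.ofReal (c j)) atTop := by
          refine liminf_le_liminf (Eventually.of_forall fun j => ?_)
          rw [← ofReal_integral_eq_lintegral_ofReal (hF j) (Eventually.of_forall (hF0 j))]
          exact ENNReal.ofReal_le_ofReal (hle j)
      _ = ENNReal.ofReal c₀ := ((ENNReal.continuous_ofReal.tendsto _).comp hc).liminf_eq
  have hi : Integrable f μ := by
    refine ⟨hm, ?_⟩
    rw [hasFiniteIntegral_iff_ofReal (Eventually.of_forall hf0)]
    exact hle'.trans_lt ENNReal.ofReal_lt_top
  refine ⟨hi, ?_⟩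
  have hc0 : 0 ≤ c₀ := ge_of_tendsto' hc fun j => (integral_nonneg (hF0 j)).trans (hle j)
  rwa [← ofReal_integral_eq_lintegral_ofReal hi (Eventually.of_forall hf0),
    ENNReal.ofReal_le_ofReal_iff hc0] at hle'

/-- The weighted inequality that follows, as the regularization of `1 / τ` is removed, from the
nonnegativity of the radial form. -/
lemma hardy_of_integral_radialForm_nonneg (hn : 3 ≤ n) {e : EuclideanSpace ℝ (Fin n)}
    (he : ‖e‖ = 1) {Ω : Set (EuclideanSpace ℝ (Fin n))} {m : EuclideanSpace ℝ (Fin n) → ℝ}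
    (hm0 : ∀ x, 0 ≤ m x) (hm : ∀ K, IsCompact K → K ⊆ Ω → IntegrableOn m K)
    (h : ∀ ζ, IsTest 1 Ω ζ → 0 ≤ ∫ x, m x * radialForm e ζ x)
    {η : EuclideanSpace ℝ (Fin n) → ℝ} (hη : IsTest 1 Ω η) :
    Integrable (fun x => m x * (η x ^ 2 / axisDist e x ^ 2)) ∧
    Integrable (fun x => m x * ‖fderiv ℝ η x‖ ^ 2) ∧
    ((n : ℝ) - 2) * ∫ x, m x * (η x ^ 2 / axisDist e x ^ 2) ≤
      ∫ x, m x * ‖fderiv ℝ η x‖ ^ 2 := by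
  obtain ⟨h1, h2, h3⟩ := hη
  have hk : (0 : ℝ) < n - 2 := by
    have : (3 : ℝ) ≤ n := by exact_mod_cast hn
    linarith
  have hmK := hm _ h2 h3
  have hdc : Continuous (fderiv ℝ η) := h1.continuous_fderiv (by simp)
  have hJ : Integrable (fun x => m x * ‖fderiv ℝ η x‖ ^ 2) :=
    integrable_mul_of_eq_zero_off h2 hmK (hdc.norm.pow 2) fun x hx => by
      simp [fderiv_apply_eq_zero_of_notMem_tsupport hx]
  let ε : ℕ → ℝ := fun j => 1 / ((j : ℝ) + 1)
  have hε (j) : 0 < ε j := by positivity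
  have hε0 : Tendsto ε atTop (𝓝 0) := tendsto_one_div_add_atTop_nhds_zero_nat
  let H : ℕ → EuclideanSpace ℝ (Fin n) → ℝ := fun j x => regInv (ε j) e x ^ 2
  have cH (j) : Continuous (H j) := (contDiff_regInv (hε j) e).continuous.pow 2
  let r : ℕ → EuclideanSpace ℝ (Fin n) → ℝ := fun j x => axisDist e x ^ 2 * H j x
  have cr (j) : Continuous (r j) := ((continuous_axisDist e).pow 2).mul (cH j)
  have hH0 (j x) : 0 ≤ H j x := sq_nonneg _
  have hr0 (j x) : 0 ≤ r j x := mul_nonneg (sq_nonneg _) (hH0 j x)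
  have hr1 (j x) : r j x ≤ 1 := by
    simp only [r, H, regInv_sq, ← div_eq_mul_inv]
    exact div_le_one_of_le₀ (by nlinarith [sq_nonneg (ε j)]) (by positivity)
  have lH : ∀ᵐ x : EuclideanSpace ℝ (Fin n),
      Tendsto (fun j => H j x) atTop (𝓝 (axisDist e x ^ 2)⁻¹) ∧
      Tendsto (fun j => r j x) atTop (𝓝 1) := by
    filter_upwards [ae_transversal_ne_zero hn he] with x hx
    have hτ : axisDist e x ^ 2 ≠ 0 := pow_ne_zero 2 (norm_ne_zero_iff.2 hx)
    have l1 : Tendsto (fun j => H j x) atTop (𝓝 (axisDist e x ^ 2)⁻¹) := by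
      simp only [H, regInv_sq]
      have := ((hε0.pow 2).const_add (axisDist e x ^ 2)).inv₀ (by simpa using hτ)
      simpa using this
    refine ⟨l1, ?_⟩
    have := l1.const_mul (axisDist e x ^ 2)
    rwa [mul_inv_cancel₀ hτ] at this
  have iF (j) : Integrable fun x => m x * (η x ^ 2 * (r j x * H j x)) :=
    integrable_mul_of_eq_zero_off h2 hmK ((h1.continuous.pow 2).mul ((cr j).mul (cH j)))
      fun x hx => by simp [image_eq_zero_of_notMem_tsupport hx]
  have lF : ∀ᵐ x, Tendsto (fun j => m x * (η x ^ 2 * (r j x * H j x))) atTop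
      (𝓝 (m x * (η x ^ 2 / axisDist e x ^ 2))) := by
    filter_upwards [lH] with x hx
    have := ((hx.2.mul hx.1).const_mul (η x ^ 2)).const_mul (m x)
    simpa [div_eq_mul_inv] using this
  -- The inequality with a loss `θ`, the parameter in Young's inequality.
  have key (θ : ℝ) (hθ : 0 < θ) (hθ1 : θ < 1) :
      Integrable (fun x => m x * (η x ^ 2 / axisDist e x ^ 2)) ∧
      ∫ x, m x * (η x ^ 2 / axisDist e x ^ 2) ≤
        ((n - 2) * (1 - θ))⁻¹ * ∫ x, m x * ‖fderiv ℝ η x‖ ^ 2 := by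
    have hkθ : 0 < ((n : ℝ) - 2) * (1 - θ) := mul_pos hk (sub_pos.2 hθ1)
    have iG (j) : Integrable fun x =>
        m x * (‖fderiv ℝ η x‖ ^ 2 * (r j x + (1 - r j x) ^ 2 / θ)) :=
      integrable_mul_of_eq_zero_off h2 hmK ((hdc.norm.pow 2).mul ((cr j).add
        (((continuous_const.sub (cr j)).pow 2).div_const θ)))
        fun x hx => by simp [fderiv_apply_eq_zero_of_notMem_tsupport hx]
    refine integrable_and_integral_le_of_tendsto iF
      (fun j x => mul_nonneg (hm0 x) (mul_nonneg (sq_nonneg _) (mul_nonneg (hr0 j x) (hH0 j x))))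
      (fun x => mul_nonneg (hm0 x) (by positivity)) lF
      (c := fun j => ((n - 2) * (1 - θ))⁻¹ *
        ∫ x, m x * (‖fderiv ℝ η x‖ ^ 2 * (r j x + (1 - r j x) ^ 2 / θ)))
      (Tendsto.const_mul _ ?_) fun j => ?_
    · refine tendsto_integral_of_dominated_convergence
        (fun x => m x * ‖fderiv ℝ η x‖ ^ 2 * (1 + 1 / θ))
        (fun j => (iG j).aestronglyMeasurable) (hJ.mul_const _)
        (fun j => Eventually.of_forall fun x => ?_) ?_
      · have hs : (1 - r j x) ^ 2 ≤ 1 := by nlinarith [hr0 j x, hr1 j x]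
        have h0 := hr0 j x
        rw [Real.norm_of_nonneg (mul_nonneg (hm0 x) (by positivity)), mul_assoc]
        refine mul_le_mul_of_nonneg_left (mul_le_mul_of_nonneg_left ?_ (sq_nonneg _)) (hm0 x)
        exact add_le_add (hr1 j x) (div_le_div_of_nonneg_right hs hθ.le)
      · filter_upwards [lH] with x hx
        have := ((hx.2.add (((hx.2.const_sub 1).pow 2).div_const θ)).const_mul
          (‖fderiv ℝ η x‖ ^ 2)).const_mul (m x)
        simpa using this
    · rw [le_inv_mul_iff₀ hkθ]
      have ht : IsTest 1 Ω fun x => η x * regInv (ε j) e x :=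
        ⟨h1.mul (contDiff_regInv (hε j) e), h2.mul_right,
          (tsupport_mul_subset_left (g := regInv (ε j) e)).trans h3⟩
      have hi : Integrable fun x => m x * radialForm e (fun y => η y * regInv (ε j) e y) x :=
        integrable_mul_of_eq_zero_off ht.2.1 (hm _ ht.2.1 ht.2.2) (continuous_radialForm e ht.1)
          fun x hx => radialForm_eq_zero_of_notMem_tsupport e hx
      have hle : ∫ x, m x * radialForm e (fun y => η y * regInv (ε j) e y) x ≤
          ∫ x, (m x * (‖fderiv ℝ η x‖ ^ 2 * (r j x + (1 - r j x) ^ 2 / θ))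
            - (n - 2) * (1 - θ) * (m x * (η x ^ 2 * (r j x * H j x)))) := by
        refine integral_mono hi ((iG j).sub ((iF j).const_mul _)) fun x => ?_
        have hx := radialForm_mul_regInv_le hn (hε j) he (r := r j x) (θ := θ)
          (h1.contDiffAt.differentiableAt (by simp) : DifferentiableAt ℝ η x) rfl hθ
        refine (mul_le_mul_of_nonneg_left hx (hm0 x)).trans_eq ?_
        simp only [H]
        ring
      rw [integral_sub (iG j) ((iF j).const_mul _), integral_const_mul] at hle
      linarith [h _ ht]
  refine ⟨(key (1 / 2) (by norm_num) (by norm_num)).1, hJ, ?_⟩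
  -- Let `θ` tend to `0`.
  have hθ0 : Tendsto (fun θ : ℝ => (n - 2) * (1 - θ) * ∫ x, m x * (η x ^ 2 / axisDist e x ^ 2))
      (𝓝[>] 0) (𝓝 ((n - 2) * (1 - 0) * ∫ x, m x * (η x ^ 2 / axisDist e x ^ 2))) := by
    refine Tendsto.mono_left (Continuous.tendsto (by fun_prop) 0) nhdsWithin_le_nhds
  rw [sub_zero, mul_one] at hθ0
  refine le_of_tendsto hθ0 ?_
  filter_upwards [Ioo_mem_nhdsGT one_pos] with θ hθ
  have := (key θ hθ.1 hθ.2).2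
  rwa [le_inv_mul_iff₀ (mul_pos hk (sub_pos.2 hθ.2))] at this

/-! ### The inequality for `u` and for `v` -/

/-- The two weighted densities agree up to a constant: `v^α v_τ² = β^α u_τ²`, because
`α / β + 2 (1 / β - 1) = 0`. -/
lemma modified_rpow_mul_derivTau_sq {γ : ℝ} (hγ : γ < 2) (e : EuclideanSpace ℝ (Fin n))
    {u : EuclideanSpace ℝ (Fin n) → ℝ} {x : EuclideanSpace ℝ (Fin n)} (hx : 0 < u x)
    (hd : DifferentiableAt ℝ u x) :
    modified γ u x ^ alphaExp γ * derivTau e (modified γ u) x ^ 2 =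
      betaExp γ ^ alphaExp γ * derivTau e u x ^ 2 := by
  have hγ' : 2 - γ ≠ 0 := by linarith
  have hβ : 0 < betaExp γ := by unfold betaExp; apply div_pos <;> linarith
  have h1 : HasFDerivAt (modified γ u)
      (betaExp γ • ((1 / betaExp γ * u x ^ (1 / betaExp γ - 1)) • fderiv ℝ u x)) x :=
    (hd.hasFDerivAt.rpow_const (Or.inl hx.ne')).const_mul (betaExp γ)
  have h2 : derivTau e (modified γ u) x = u x ^ (1 / betaExp γ - 1) * derivTau e u x := by
    rw [derivTau, h1.fderiv, derivTau]
    simp only [_root_.smul_apply, smul_eq_mul]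
    field_simp
  have h3 : u x ^ (1 / betaExp γ * alphaExp γ) * (u x ^ (1 / betaExp γ - 1)) ^ 2 = 1 := by
    rw [← Real.rpow_mul_natCast hx.le, ← Real.rpow_add hx]
    have : 1 / betaExp γ * alphaExp γ + (1 / betaExp γ - 1) * (2 : ℕ) = 0 := by
      rw [betaExp, alphaExp]; push_cast; field_simp; ring
    rw [this, Real.rpow_zero]
  rw [h2, modified, Real.mul_rpow hβ.le (Real.rpow_nonneg hx.le _), ← Real.rpow_mul hx.le]
  linear_combination betaExp γ ^ alphaExp γ * derivTau e u x ^ 2 * h3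

end AltPhillips

end

theorem mainTheorem3 (n : ℕ) (hn : 3 ≤ n) (γ : ℝ) (hγ_pos : 0 < γ) (hγ_lt : γ < 2)
    (Ω : Set (EuclideanSpace ℝ (Fin n))) (hΩ_open : IsOpen Ω) (hΩ_conn : IsConnected Ω)
    (u : EuclideanSpace ℝ (Fin n) → ℝ) (hu_cont : ContinuousOn u Ω) (hu_nonneg : ∀ x ∈ Ω, 0 ≤ u x)
    (hu_stable : AltPhillips.IsStableCriticalPoint γ Ω u)
    (e : EuclideanSpace ℝ (Fin n)) (he : ‖e‖ = 1)
    (hu_symm : AltPhillips.IsAxiallySymmetric e Ω u)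
    (h_zero : (0 : EuclideanSpace ℝ (Fin n)) ∈ AltPhillips.freeBoundary Ω u)
    (h_fb : ∀ p ∈ AltPhillips.freeBoundary Ω u, p ≠ 0 →
      AltPhillips.IsSmoothHypersurfaceAt (AltPhillips.freeBoundary Ω u) p)
    (h_smooth : ∀ p ∈ closure (AltPhillips.positivitySet Ω u) ∩ Ω, p ≠ 0 →
      AltPhillips.IsSmoothUpToAt (AltPhillips.positivitySet Ω u) (AltPhillips.modified γ u) p)
    (η : EuclideanSpace ℝ (Fin n) → ℝ) (hη : AltPhillips.IsTest 1 Ω η) :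
    (IntegrableOn
        (fun x => AltPhillips.derivTau e u x ^ 2 / AltPhillips.axisDist e x ^ 2 * η x ^ 2)
        (AltPhillips.positivitySet Ω u) ∧
      IntegrableOn (fun x => AltPhillips.derivTau e u x ^ 2 * ‖gradient η x‖ ^ 2)
        (AltPhillips.positivitySet Ω u) ∧
      ((n : ℝ) - 2) * (∫ x in AltPhillips.positivitySet Ω u,
          AltPhillips.derivTau e u x ^ 2 / AltPhillips.axisDist e x ^ 2 * η x ^ 2)
        ≤ ∫ x in AltPhillips.positivitySet Ω u,
          AltPhillips.derivTau e u x ^ 2 * ‖gradient η x‖ ^ 2) ∧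
    (IntegrableOn
        (fun x => AltPhillips.modified γ u x ^ AltPhillips.alphaExp γ *
          (AltPhillips.derivTau e (AltPhillips.modified γ u) x ^ 2
            / AltPhillips.axisDist e x ^ 2) * η x ^ 2)
        (AltPhillips.positivitySet Ω u) ∧
      IntegrableOn
        (fun x => AltPhillips.modified γ u x ^ AltPhillips.alphaExp γ *
          AltPhillips.derivTau e (AltPhillips.modified γ u) x ^ 2 * ‖gradient η x‖ ^ 2)
        (AltPhillips.positivitySet Ω u) ∧
      ((n : ℝ) - 2) * (∫ x in AltPhillips.positivitySet Ω u,
          AltPhillips.modified γ u x ^ AltPhillips.alphaExp γ *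
            (AltPhillips.derivTau e (AltPhillips.modified γ u) x ^ 2
              / AltPhillips.axisDist e x ^ 2) * η x ^ 2)
        ≤ ∫ x in AltPhillips.positivitySet Ω u,
          AltPhillips.modified γ u x ^ AltPhillips.alphaExp γ *
            AltPhillips.derivTau e (AltPhillips.modified γ u) x ^ 2 * ‖gradient η x‖ ^ 2) := by
  set P := AltPhillips.positivitySet Ω u with hP
  have hPo : IsOpen P := AltPhillips.isOpen_positivitySet hΩ_open hu_cont
  have h0P : (0 : EuclideanSpace ℝ (Fin n)) ∉ P := fun h => by
    have := h_zero.1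
    rw [hPo.frontier_eq] at this
    exact this.2 h
  have hu1 : ∀ x ∈ P, ContDiffAt ℝ 1 u x := fun x hx =>
    AltPhillips.contDiffAt_of_isSmoothUpToAt hγ_lt hΩ_open hu_cont hx
      (h_smooth x ⟨subset_closure hx, hx.1⟩ fun h => h0P (h ▸ hx))
  obtain ⟨g, hg, hst⟩ := hu_stable
  have hm := fun K hK hKΩ => AltPhillips.derivTauSq_integrableOn hn he hΩ_open hu_cont hu_nonneg
    hu1 hu_symm hg (K := K) hK hKΩ
  obtain ⟨i1, i2, hle⟩ := AltPhillips.hardy_of_integral_radialForm_nonneg hn he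
    (AltPhillips.derivTauSq_nonneg e Ω u) hm
    (fun ζ hζ => AltPhillips.integral_radialForm_nonneg_of_smooth hn e hΩ_open hm
      (fun ζ hζ => AltPhillips.integral_radialForm_nonneg hn he hΩ_open hu_cont hu_nonneg hu1
        hu_symm hg hst hζ) hζ) hη
  -- The integrals of the extension of `u_τ²` by zero are integrals over the positivity set.
  have e1 : (fun x => AltPhillips.derivTauSq e Ω u x * (η x ^ 2 / AltPhillips.axisDist e x ^ 2)) =
      P.indicator fun x =>
        AltPhillips.derivTau e u x ^ 2 / AltPhillips.axisDist e x ^ 2 * η x ^ 2 := by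
    ext x
    by_cases hx : x ∈ P
    · rw [AltPhillips.derivTauSq, indicator_of_mem hx, indicator_of_mem hx]; ring
    · rw [AltPhillips.derivTauSq, indicator_of_notMem hx, indicator_of_notMem hx, zero_mul]
  have e2 : (fun x => AltPhillips.derivTauSq e Ω u x * ‖fderiv ℝ η x‖ ^ 2) =
      P.indicator fun x => AltPhillips.derivTau e u x ^ 2 * ‖gradient η x‖ ^ 2 := by
    ext x
    simp_rw [AltPhillips.norm_gradient]
    by_cases hx : x ∈ P
    · rw [AltPhillips.derivTauSq, indicator_of_mem hx, indicator_of_mem hx]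
    · rw [AltPhillips.derivTauSq, indicator_of_notMem hx, indicator_of_notMem hx, zero_mul]
  rw [e1, integrable_indicator_iff hPo.measurableSet] at i1
  rw [e2, integrable_indicator_iff hPo.measurableSet] at i2
  rw [e1, e2, integral_indicator hPo.measurableSet, integral_indicator hPo.measurableSet] at hle
  set B := AltPhillips.betaExp γ ^ AltPhillips.alphaExp γ with hB
  have hB0 : 0 ≤ B := by
    rw [hB, AltPhillips.betaExp]
    exact Real.rpow_nonneg (div_nonneg zero_le_two (by linarith)) _
  have hv := fun x (hx : x ∈ P) => AltPhillips.modified_rpow_mul_derivTau_sq hγ_lt e hx.2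
    ((hu1 x hx).differentiableAt (by simp))
  have f1 : EqOn (fun x => B *
      (AltPhillips.derivTau e u x ^ 2 / AltPhillips.axisDist e x ^ 2 * η x ^ 2))
      (fun x => AltPhillips.modified γ u x ^ AltPhillips.alphaExp γ *
        (AltPhillips.derivTau e (AltPhillips.modified γ u) x ^ 2
          / AltPhillips.axisDist e x ^ 2) * η x ^ 2) P := fun x hx => by
    simp only
    rw [← mul_div_assoc, hv x hx]; ring
  have f2 : EqOn (fun x => B * (AltPhillips.derivTau e u x ^ 2 * ‖gradient η x‖ ^ 2))
      (fun x => AltPhillips.modified γ u x ^ AltPhillips.alphaExp γ *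
        AltPhillips.derivTau e (AltPhillips.modified γ u) x ^ 2 * ‖gradient η x‖ ^ 2) P :=
    fun x hx => by
      simp only
      rw [hv x hx]; ring
  refine ⟨⟨i1, i2, hle⟩, IntegrableOn.congr_fun (i1.const_mul B) f1 hPo.measurableSet,
    IntegrableOn.congr_fun (i2.const_mul B) f2 hPo.measurableSet, ?_⟩
  rw [← setIntegral_congr_fun hPo.measurableSet f1, ← setIntegral_congr_fun hPo.measurableSet f2,
    integral_const_mul, integral_const_mul, mul_left_comm]
  exact mul_le_mul_of_nonneg_left hle hB0
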